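/- Let $M$ be an $m$-dimensional (Hausdorff) $C^\infty$ manifold and $\mathbf TM=TM\oplus T^*M$, with the neutral metric $g((X,\alpha),(Y,\mu))=\alpha(Y)+\mu(X)$ and the Courant bracket $$[(X,\alpha),(Y,\mu)]=\bigl([X,Y],\,L_X\mu-L_Y\alpha+\tfrac12 d(\alpha(Y)-\mu(X))\bigr).$$ Let $G$ be a generalized Riemannian metric on $M$, i.e. $G(\cdot,\cdot)=g(\phi\,\cdot,\cdot)$ is positive definite for a smooth endomorphism $\phi$ of $\mathbf TM$ with $\phi^2=\mathrm{Id}$ and $g(\phi\,\cdot,\phi\,\cdot)=g$, and let $(\gamma,\psi)$ be the corresponding pair of a Riemannian metric $\gamma$ and a $2$-form $\psi$ on $M$: the $\pm1$-eigenbundles of $\phi$ are $V_\pm=\{(X,\flat_{\psi\pm\gamma}X): X\in TM\}$, where $\flat_{\psi\pm\gamma}X=\psi(X,\cdot)\pm\gamma(X,\cdot)$. Let $D$ be the Levi-Civita connection of $\gamma$, put $D^\pm_XY=D_XY\pm\tfrac12\sharp_\gamma[d\psi(X,Y,\cdot)]$, and let $\nabla$ be the canonical big connection of $G$, i.e. the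 connection on $\mathbf TM=V_+\oplus V_-$ with $$\nabla_X(Y,\flat_{\psi\pm\gamma}Y)=(D^\pm_XY,\flat_{\psi\pm\gamma}D^\pm_XY).$$ Let $E\subset\mathbf TM$ be an almost Dirac structure, i.e. a smooth maximal $g$-isotropic subbundle (of rank $m$), let $\Psi_E$ be the endomorphism of $\mathbf TM$ with $+1$-eigenbundle $E$ and $-1$-eigenbundle $\phi(E)$, and let $F_E$ be the isometry of $(TM,\gamma)$ defined by $\Psi_E(X,\flat_{\psi+\gamma}X)=(F_EX,\flat_{\psi-\gamma}F_EX)$. Then $E$ is a parallel Dirac structure (that is, the space $\Gamma E$ of smooth sections of $E$ is closed under the Courant bracket, and $\nabla_X\mathcal Y\in\Gamma E$ for every vector field $X$ and every $\mathcal Y\in\Gamma E$) if and only if, for all vector fields $X,Y,Z$ on $M$, $$\gamma(F_EZ,(D_XF_E)Y)=\tfrac12\bigl[d\psi(X,Y,Z)+d\psi(X,F_EY,F_EZ)\bigr]$$ and $$d\psi(X,Y,Z)+d\psi(F_EX,F_EY,F_EZ)=0 .$$ -/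

import Mathlib

open scoped Manifold ContDiff Bundle

noncomputable section

namespace GenRiem

open Bundle VectorField Module

variable {m : ℕ} {M : Type*} [TopologicalSpace M] [ChartedSpace (EuclideanSpace ℝ (Fin m)) M]

/-! ### Vector fields, one-forms, sections of the big tangent bundle -/

/-- The tangent space of the `m`-dimensional manifold `M` at `x`. -/
abbrev Tan (m : ℕ) {M : Type*} [TopologicalSpace M] [ChartedSpace (EuclideanSpace ℝ (Fin m)) M]
    (x : M) : Type := TangentSpace (𝓡 m) x

/-- The fibre at `x` of the big tangent bundle `TM ⊕ T*M`. -/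
abbrev Big (m : ℕ) {M : Type*} [TopologicalSpace M] [ChartedSpace (EuclideanSpace ℝ (Fin m)) M]
    (x : M) : Type := Tan m x × (Tan m x →L[ℝ] ℝ)

instance (x : M) : FiniteDimensional ℝ (Tan m x) :=
  inferInstanceAs (FiniteDimensional ℝ (EuclideanSpace ℝ (Fin m)))

instance (x : M) : T2Space (Tan m x) :=
  inferInstanceAs (T2Space (EuclideanSpace ℝ (Fin m)))

instance (x : M) : FiniteDimensional ℝ (Tan m x →L[ℝ] ℝ) :=
  LinearEquiv.finiteDimensional
    (LinearMap.toContinuousLinearMap : (Tan m x →ₗ[ℝ] ℝ) ≃ₗ[ℝ] (Tan m x →L[ℝ] ℝ))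

theorem finrank_tan (x : M) : finrank ℝ (Tan m x) = m :=
  finrank_euclideanSpace_fin (𝕜 := ℝ) (n := m)

theorem finrank_cotan (x : M) : finrank ℝ (Tan m x →L[ℝ] ℝ) = m := by
  rw [← (LinearMap.toContinuousLinearMap :
    (Tan m x →ₗ[ℝ] ℝ) ≃ₗ[ℝ] (Tan m x →L[ℝ] ℝ)).finrank_eq]
  exact (Subspace.dual_finrank_eq (K := ℝ) (V := Tan m x)).trans (finrank_tan x)

theorem finrank_big (x : M) : finrank ℝ (Big m x) = m + m := by
  rw [finrank_prod, finrank_tan, finrank_cotan]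

section smooth

variable [IsManifold (𝓡 m) ∞ M]

/-- `X` is a `C^∞` vector field on `M`. -/
def SmoothVF (X : Π x : M, Tan m x) : Prop :=
  ContMDiff (𝓡 m) ((𝓡 m).prod 𝓘(ℝ, EuclideanSpace ℝ (Fin m))) ∞
    (fun x ↦ TotalSpace.mk' (EuclideanSpace ℝ (Fin m)) x (X x))

/-- `(X, α)` is a `C^∞` section over `U` of the big tangent bundle: its components are a `C^∞`
vector field and a `C^∞` one-form on `U`. -/
def SmoothBigOn (U : Set M) (S : Π x : M, Big m x) : Prop :=
  ContMDiffOn (𝓡 m) ((𝓡 m).prod 𝓘(ℝ, EuclideanSpace ℝ (Fin m))) ∞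
    (fun x ↦ TotalSpace.mk' (EuclideanSpace ℝ (Fin m)) x (S x).1) U ∧
  ContMDiffOn (𝓡 m) ((𝓡 m).prod 𝓘(ℝ, EuclideanSpace ℝ (Fin m) →L[ℝ] ℝ)) ∞
    (fun x ↦ TotalSpace.mk' (EuclideanSpace ℝ (Fin m) →L[ℝ] ℝ)
      (E := fun x : M ↦ Tan m x →L[ℝ] ℝ) x (S x).2) U

/-- `S` is a global `C^∞` section of the big tangent bundle. -/
def SmoothBig (S : Π x : M, Big m x) : Prop := SmoothBigOn Set.univ S

end smooth

/-- The neutral metric `g((X,α),(Y,μ)) = α(Y) + μ(X)`. -/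
def neutral {x : M} (u v : Big m x) : ℝ := u.2 v.1 + v.2 u.1

/-! ### Exterior derivative, Lie derivative, Courant bracket -/

/-- The exterior derivative of an `n`-form: read the form in the preferred chart at `x₀`, take
the exterior derivative in the model space, and pull the result back to `M`. -/
def extD {n : ℕ} (θ : Π x : M, Tan m x [⋀^Fin n]→L[ℝ] ℝ) (x₀ : M) :
    Tan m x₀ [⋀^Fin (n + 1)]→L[ℝ] ℝ :=
  (extDerivWithin
    (fun y : EuclideanSpace ℝ (Fin m) ↦
      ((θ ((extChartAt (𝓡 m) x₀).symm y)).compContinuousLinearMap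
        (mfderivWithin 𝓘(ℝ, EuclideanSpace ℝ (Fin m)) (𝓡 m) (extChartAt (𝓡 m) x₀).symm
          (Set.range (𝓡 m)) y) : EuclideanSpace ℝ (Fin m) [⋀^Fin n]→L[ℝ] ℝ))
    (Set.range (𝓡 m)) (extChartAt (𝓡 m) x₀ x₀)).compContinuousLinearMap
    (mfderiv (𝓡 m) 𝓘(ℝ, EuclideanSpace ℝ (Fin m)) (extChartAt (𝓡 m) x₀) x₀)

/-- A one-form, viewed as a field of alternating maps in one variable. -/
def oneFormAlt (μ : Π x : M, Tan m x →L[ℝ] ℝ) (x : M) : Tan m x [⋀^Fin 1]→L[ℝ] ℝ :=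
  ContinuousAlternatingMap.ofSubsingleton ℝ (Tan m x) ℝ (0 : Fin 1) (μ x)

theorem update_two {A : Type*} (v w z : A) : Function.update ![v, w] 1 z = ![v, z] := by
  ext i; fin_cases i <;> rfl

theorem update_three {A : Type*} (v w u z : A) :
    Function.update ![v, w, u] 2 z = ![v, w, z] := by
  ext i; fin_cases i <;> rfl

/-- Interior product `i(X)η = η(X, ·)` of a tangent vector with an alternating bilinear form. -/
def interior₂ {x : M} (v : Tan m x) (η : Tan m x [⋀^Fin 2]→L[ℝ] ℝ) : Tan m x →L[ℝ] ℝ :=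
  LinearMap.toContinuousLinearMap
    { toFun := fun w ↦ η ![v, w]
      map_add' := fun a b ↦ by
        have h := η.map_update_add ![v, 0] 1 a b
        rwa [update_two, update_two, update_two] at h
      map_smul' := fun c a ↦ by
        have h := η.map_update_smul ![v, 0] 1 c a
        rwa [update_two, update_two] at h }

/-- `i(Y)i(X)η = η(X, Y, ·)` for an alternating trilinear form. -/
def interior₃ {x : M} (v w : Tan m x) (η : Tan m x [⋀^Fin 3]→L[ℝ] ℝ) : Tan m x →L[ℝ] ℝ :=
  LinearMap.toContinuousLinearMap
    { toFun := fun z ↦ η ![v, w, z]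
      map_add' := fun a b ↦ by
        have h := η.map_update_add ![v, w, 0] 2 a b
        rwa [update_three, update_three, update_three] at h
      map_smul' := fun c a ↦ by
        have h := η.map_update_smul ![v, w, 0] 2 c a
        rwa [update_three, update_three] at h }

/-- The Lie derivative of a one-form, `L_X μ = i(X) dμ + d(μ(X))`. -/
def lieD (X : Π x : M, Tan m x) (μ : Π x : M, Tan m x →L[ℝ] ℝ) (x : M) : Tan m x →L[ℝ] ℝ :=
  interior₂ (X x) (extD (oneFormAlt μ) x) + mvfderiv (𝓡 m) (fun y ↦ μ y (X y)) x

/-- The Courant bracket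
`[(X,α),(Y,μ)] = ([X,Y], L_X μ - L_Y α + (1/2) d(α(Y) - μ(X)))`. -/
def courant (S T : Π x : M, Big m x) (x : M) : Big m x :=
  (mlieBracket (𝓡 m) (fun y ↦ (S y).1) (fun y ↦ (T y).1) x,
    lieD (fun y ↦ (S y).1) (fun y ↦ (T y).2) x - lieD (fun y ↦ (T y).1) (fun y ↦ (S y).2) x
      + (1 / 2 : ℝ) • mvfderiv (𝓡 m) (fun y ↦ (S y).2 (T y).1 - (T y).2 (S y).1) x)

/-! ### Riemannian metrics, two-forms, Levi-Civita connection -/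

section geometry

variable [IsManifold (𝓡 m) ∞ M]

/-- A `C^∞` Riemannian metric on `M`. -/
abbrev RMetric (m : ℕ) (M : Type*) [TopologicalSpace M]
    [ChartedSpace (EuclideanSpace ℝ (Fin m)) M] [IsManifold (𝓡 m) ∞ M] :=
  ContMDiffRiemannianMetric (𝓡 m) ∞ (EuclideanSpace ℝ (Fin m)) (fun x : M ↦ Tan m x)

/-- A `C^∞` two-form on `M`. -/
structure TwoForm (m : ℕ) (M : Type*) [TopologicalSpace M]
    [ChartedSpace (EuclideanSpace ℝ (Fin m)) M] [IsManifold (𝓡 m) ∞ M] where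
  /-- the bilinear form on each tangent space -/
  form (x : M) : Tan m x →L[ℝ] Tan m x →L[ℝ] ℝ
  alt (x : M) (v : Tan m x) : form x v v = 0
  contMDiff : ContMDiff (𝓡 m)
    ((𝓡 m).prod 𝓘(ℝ, EuclideanSpace ℝ (Fin m) →L[ℝ] EuclideanSpace ℝ (Fin m) →L[ℝ] ℝ)) ∞
    (fun x ↦ TotalSpace.mk'
      (EuclideanSpace ℝ (Fin m) →L[ℝ] EuclideanSpace ℝ (Fin m) →L[ℝ] ℝ)
      (E := fun x : M ↦ Tan m x →L[ℝ] Tan m x →L[ℝ] ℝ) x (form x))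

/-- The two-form as a field of alternating maps. -/
def TwoForm.toAlt (ψ : TwoForm m M) (x : M) : Tan m x [⋀^Fin 2]→L[ℝ] ℝ where
  toFun v := ψ.form x (v 0) (v 1)
  map_update_add' := by
    intro inst v i a b
    have h : inst = instDecidableEqFin 2 := Subsingleton.elim _ _
    subst h
    fin_cases i <;> simp
  map_update_smul' := by
    intro inst v i c a
    have h : inst = instDecidableEqFin 2 := Subsingleton.elim _ _
    subst h
    fin_cases i <;> simp
  map_eq_zero_of_eq' v i j h hij := by
    fin_cases i <;> fin_cases j <;> simp_all [ψ.alt]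
  cont := by
    have h : Continuous (fun p : Tan m x × Tan m x ↦ ψ.form x p.1 p.2) := by
      have h' := (isBoundedBilinearMap_apply (𝕜 := ℝ) (E := EuclideanSpace ℝ (Fin m))
        (F := ℝ)).continuous
      exact h'.comp (((ψ.form x).continuous.comp continuous_fst).prodMk continuous_snd)
    have h0 : Continuous (fun v : Fin 2 → Tan m x ↦ (v 0, v 1)) :=
      (continuous_apply (0 : Fin 2)).prodMk (continuous_apply (1 : Fin 2))
    exact h.comp h0

/-- The three-form `dψ`. -/
def TwoForm.d (ψ : TwoForm m M) (x : M) : Tan m x [⋀^Fin 3]→L[ℝ] ℝ := extD ψ.toAlt x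

/-- The musical isomorphism `♭_γ : T_x M → T_x^* M`. -/
def flatEquiv (γ : RMetric m M) (x : M) : Tan m x ≃ₗ[ℝ] (Tan m x →L[ℝ] ℝ) :=
  LinearEquiv.ofInjectiveOfFinrankEq (γ.inner x : Tan m x →ₗ[ℝ] (Tan m x →L[ℝ] ℝ))
    (by
      rw [injective_iff_map_eq_zero]
      intro v hv
      by_contra hne
      have h := γ.pos x v hne
      have h' : γ.inner x v v = 0 := by
        have := congrArg (fun f : Tan m x →L[ℝ] ℝ ↦ f v) hv
        simpa using this
      linarith)
    (by rw [finrank_tan, finrank_cotan])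

/-- The musical isomorphism `♯_γ : T_x^* M → T_x M`, inverse of `♭_γ`. -/
def sharp (γ : RMetric m M) (x : M) : (Tan m x →L[ℝ] ℝ) ≃ₗ[ℝ] Tan m x := (flatEquiv γ x).symm

/-- `γ(X, Y)` as a function on `M`. -/
def pair (γ : RMetric m M) (X Y : Π x : M, Tan m x) (x : M) : ℝ := γ.inner x (X x) (Y x)

/-- `X` is differentiable at `x`. -/
def DiffVF (X : Π x : M, Tan m x) (x : M) : Prop :=
  MDifferentiableAt (𝓡 m) ((𝓡 m).prod 𝓘(ℝ, EuclideanSpace ℝ (Fin m)))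
    (fun y ↦ TotalSpace.mk' (EuclideanSpace ℝ (Fin m)) y (X y)) x

theorem pair_diff (γ : RMetric m M) {X Y : Π x : M, Tan m x} {x : M}
    (hX : DiffVF X x) (hY : DiffVF Y x) :
    MDifferentiableAt (𝓡 m) 𝓘(ℝ) (pair γ X Y) x := by
  let _ : RiemannianBundle (fun x : M ↦ Tan m x) := ⟨γ.toRiemannianMetric⟩
  exact MDifferentiableAt.inner_bundle (F := EuclideanSpace ℝ (Fin m)) (E := fun x : M ↦ Tan m x)
    (b := id) hX hY

/-- The Koszul expression: half of
`X γ(Y,Z) + Y γ(X,Z) - Z γ(X,Y) + γ([X,Y],Z) - γ([X,Z],Y) - γ([Y,Z],X)`. -/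
def koszul (γ : RMetric m M) (X Y Z : Π x : M, Tan m x) (x : M) : ℝ :=
  (1 / 2) * (mvfderiv (𝓡 m) (pair γ Y Z) x (X x) + mvfderiv (𝓡 m) (pair γ X Z) x (Y x)
    - mvfderiv (𝓡 m) (pair γ X Y) x (Z x)
    + γ.inner x (mlieBracket (𝓡 m) X Y x) (Z x)
    - γ.inner x (mlieBracket (𝓡 m) X Z x) (Y x)
    - γ.inner x (mlieBracket (𝓡 m) Y Z x) (X x))

theorem pair_add_left (γ : RMetric m M) (X X' Y : Π x : M, Tan m x) :
    pair γ (X + X') Y = fun x ↦ pair γ X Y x + pair γ X' Y x := by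
  ext x; simp [pair]

theorem pair_smul_left (γ : RMetric m M) (f : M → ℝ) (X Y : Π x : M, Tan m x) :
    pair γ (f • X) Y = fun x ↦ f x * pair γ X Y x := by
  ext x; simp [pair]

theorem pair_comm (γ : RMetric m M) (X Y : Π x : M, Tan m x) : pair γ X Y = pair γ Y X := by
  ext x; exact γ.symm x _ _

theorem pair_add_right (γ : RMetric m M) (X Y Y' : Π x : M, Tan m x) :
    pair γ X (Y + Y') = fun x ↦ pair γ X Y x + pair γ X Y' x := by
  ext x; simp [pair]

theorem pair_smul_right (γ : RMetric m M) (f : M → ℝ) (X Y : Π x : M, Tan m x) :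
    pair γ X (f • Y) = fun x ↦ f x * pair γ X Y x := by
  ext x; simp [pair]

theorem koszul_tensorial_fst (γ : RMetric m M) {Y Z : Π x : M, Tan m x} {x : M}
    (hY : DiffVF Y x) (hZ : DiffVF Z x) :
    TensorialAt (𝓡 m) (EuclideanSpace ℝ (Fin m)) (fun X ↦ koszul γ X Y Z x) x where
  smul {f X} hf hX := by
    simp only [koszul, pair_smul_left, mvfderiv_fun_mul hf (pair_diff γ hX hZ),
      mvfderiv_fun_mul hf (pair_diff γ hX hY), mlieBracket_smul_left hf hX]
    simp [pair]
    rw [γ.symm x (X x) (Z x), γ.symm x (X x) (Y x)]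
    ring
  add {X X'} hX hX' := by
    simp only [koszul, pair_add_left, mvfderiv_fun_add (pair_diff γ hX hZ) (pair_diff γ hX' hZ),
      mvfderiv_fun_add (pair_diff γ hX hY) (pair_diff γ hX' hY), mlieBracket_add_left hX hX']
    simp
    ring

theorem koszul_tensorial_thd (γ : RMetric m M) {X Y : Π x : M, Tan m x} {x : M}
    (hX : DiffVF X x) (hY : DiffVF Y x) :
    TensorialAt (𝓡 m) (EuclideanSpace ℝ (Fin m)) (fun Z ↦ koszul γ X Y Z x) x where
  smul {f Z} hf hZ := by
    simp only [koszul, pair_smul_right, mvfderiv_fun_mul hf (pair_diff γ hX hZ),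
      mvfderiv_fun_mul hf (pair_diff γ hY hZ), mlieBracket_smul_right hf hZ]
    simp [pair]
    rw [γ.symm x (X x) (Z x), γ.symm x (Y x) (Z x)]
    ring
  add {Z Z'} hZ hZ' := by
    simp only [koszul, pair_add_right, mvfderiv_fun_add (pair_diff γ hX hZ) (pair_diff γ hX hZ'),
      mvfderiv_fun_add (pair_diff γ hY hZ) (pair_diff γ hY hZ'), mlieBracket_add_right hZ hZ']
    simp
    ring

theorem koszul_add_snd (γ : RMetric m M) {X Y Y' Z : Π x : M, Tan m x} {x : M}
    (hX : DiffVF X x) (hY : DiffVF Y x) (hY' : DiffVF Y' x) (hZ : DiffVF Z x) :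
    koszul γ X (Y + Y') Z x = koszul γ X Y Z x + koszul γ X Y' Z x := by
  simp only [koszul, pair_add_left, pair_add_right,
    mvfderiv_fun_add (pair_diff γ hX hY) (pair_diff γ hX hY'),
    mvfderiv_fun_add (pair_diff γ hY hZ) (pair_diff γ hY' hZ),
    mlieBracket_add_left hY hY', mlieBracket_add_right hY hY']
  simp
  ring

theorem koszul_smul_snd (γ : RMetric m M) {X Y Z : Π x : M, Tan m x} {f : M → ℝ} {x : M}
    (hf : MDifferentiableAt (𝓡 m) 𝓘(ℝ) f x)
    (hX : DiffVF X x) (hY : DiffVF Y x) (hZ : DiffVF Z x) :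
    koszul γ X (f • Y) Z x =
      f x * koszul γ X Y Z x + mvfderiv (𝓡 m) f x (X x) * γ.inner x (Y x) (Z x) := by
  simp only [koszul, pair_smul_left, pair_smul_right,
    mvfderiv_fun_mul hf (pair_diff γ hX hY), mvfderiv_fun_mul hf (pair_diff γ hY hZ),
    mlieBracket_smul_left hf hY, mlieBracket_smul_right hf hY]
  simp [pair]
  rw [γ.symm x (X x) (Y x)]
  ring

open scoped Classical in
/-- The covector-valued form `v ↦ γ(D_v Y, ·)` at `x` of the Levi-Civita connection, given by the
Koszul formula (`0` if `Y` is not differentiable at `x`). -/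
def koszulForm (γ : RMetric m M) (Y : Π x : M, Tan m x) (x : M) :
    Tan m x →L[ℝ] Tan m x →L[ℝ] ℝ :=
  if hY : DiffVF Y x then
    TensorialAt.mkHom₂ (I := 𝓡 m) (F := EuclideanSpace ℝ (Fin m))
      (F' := EuclideanSpace ℝ (Fin m)) (V := fun x : M ↦ Tan m x) (V' := fun x : M ↦ Tan m x)
      (fun X Z ↦ koszul γ X Y Z x) x
      (fun _ hZ ↦ koszul_tensorial_fst γ hY hZ) (fun _ hX ↦ koszul_tensorial_thd γ hX hY)
  else 0

theorem koszulForm_apply (γ : RMetric m M) {X Y Z : Π x : M, Tan m x} {x : M}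
    (hX : DiffVF X x) (hY : DiffVF Y x) (hZ : DiffVF Z x) :
    koszulForm γ Y x (X x) (Z x) = koszul γ X Y Z x := by
  rw [koszulForm, dif_pos hY]
  exact TensorialAt.mkHom₂_apply _ _ hX hZ

theorem exists_diffVF {x : M} (v : Tan m x) : ∃ X : Π x : M, Tan m x, DiffVF X x ∧ X x = v :=
  ⟨FiberBundle.extend (EuclideanSpace ℝ (Fin m)) v, FiberBundle.mdifferentiableAt_extend .., by simp⟩

theorem inner_sharp (γ : RMetric m M) (x : M) (α : Tan m x →L[ℝ] ℝ) (v : Tan m x) :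
    γ.inner x (sharp γ x α) v = α v :=
  congrArg (fun f : Tan m x →L[ℝ] ℝ ↦ f v) ((flatEquiv γ x).apply_symm_apply α)

theorem ext_inner (γ : RMetric m M) {x : M} {u w : Tan m x}
    (h : ∀ v, γ.inner x u v = γ.inner x w v) : u = w :=
  (flatEquiv γ x).injective (ContinuousLinearMap.ext h)

/-- The Levi-Civita connection of `γ`, defined by the Koszul formula;
`leviCivita γ Y x v` is `(D_v Y)(x)`. -/
def leviCivita (γ : RMetric m M) :
    CovariantDerivative (𝓡 m) (EuclideanSpace ℝ (Fin m)) (fun x : M ↦ Tan m x) where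
  toFun Y x := LinearMap.toContinuousLinearMap
    ((sharp γ x : (Tan m x →L[ℝ] ℝ) →ₗ[ℝ] Tan m x) ∘ₗ
      (koszulForm γ Y x : Tan m x →ₗ[ℝ] (Tan m x →L[ℝ] ℝ)))
  isCovariantDerivativeOnUniv :=
    { add := by
        intro Y Y' x hY hY' _
        ext1 v
        refine ext_inner γ fun z ↦ ?_
        obtain ⟨X, hX, rfl⟩ := exists_diffVF v
        obtain ⟨Z, hZ, rfl⟩ := exists_diffVF z
        have hs : DiffVF (Y + Y') x := mdifferentiableAt_add_section hY hY'
        simp only [add_apply, map_add]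
        simp only [LinearMap.coe_toContinuousLinearMap', LinearMap.comp_apply,
          LinearEquiv.coe_coe, ContinuousLinearMap.coe_coe, inner_sharp]
        rw [koszulForm_apply γ hX hs hZ, koszulForm_apply γ hX hY hZ, koszulForm_apply γ hX hY' hZ,
          koszul_add_snd γ hX hY hY' hZ]
      leibniz := by
        intro Y f x hY hf _
        ext1 v
        refine ext_inner γ fun z ↦ ?_
        obtain ⟨X, hX, rfl⟩ := exists_diffVF v
        obtain ⟨Z, hZ, rfl⟩ := exists_diffVF z
        have hs : DiffVF (f • Y) x := hf.smul_section hY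
        simp only [add_apply, smul_apply, map_add,
          map_smul, ContinuousLinearMap.smulRight_apply, smul_eq_mul]
        simp only [LinearMap.coe_toContinuousLinearMap', LinearMap.comp_apply,
          LinearEquiv.coe_coe, ContinuousLinearMap.coe_coe, inner_sharp]
        rw [koszulForm_apply γ hX hs hZ, koszulForm_apply γ hX hY hZ,
          koszul_smul_snd γ hf hX hY hZ] }

/-! ### Generalized Riemannian metrics and the canonical big connection -/

/-- `♭_{ψ + sγ}`, i.e. `X ↦ ψ(X, ·) + s γ(X, ·)`; used with `s = 1` and `s = -1`. -/
def flatPM (s : ℝ) (γ : RMetric m M) (ψ : TwoForm m M) (x : M) :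
    Tan m x →L[ℝ] Tan m x →L[ℝ] ℝ := ψ.form x + s • γ.inner x

/-- A generalized Riemannian metric, given by the endomorphism `φ` of the big tangent bundle with
`φ² = Id`, `g(φ·, φ·) = g` and `G = g(φ·, ·)` positive definite. -/
structure GenMetric (m : ℕ) (M : Type*) [TopologicalSpace M]
    [ChartedSpace (EuclideanSpace ℝ (Fin m)) M] [IsManifold (𝓡 m) ∞ M] where
  /-- the endomorphism of each fibre -/
  φ (x : M) : Big m x →ₗ[ℝ] Big m x
  smooth (S : Π x : M, Big m x) : SmoothBig S → SmoothBig (fun x ↦ φ x (S x))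
  invol (x : M) (u : Big m x) : φ x (φ x u) = u
  isometry (x : M) (u v : Big m x) : neutral (φ x u) (φ x v) = neutral u v
  pos (x : M) (u : Big m x) (hu : u ≠ 0) : 0 < neutral (φ x u) u

/-- The eigenbundles `V_+` (`s = 1`) and `V_-` (`s = -1`) of `φ`. -/
def GenMetric.V (G : GenMetric m M) (s : ℝ) (x : M) : Submodule ℝ (Big m x) :=
  End.eigenspace (G.φ x) s

/-- `G ↔ (γ, ψ)`: the eigenbundles of `G` are `V_± = {(X, ♭_{ψ ± γ} X) : X ∈ TM}`. -/
def GenMetric.Corresponds (G : GenMetric m M) (γ : RMetric m M) (ψ : TwoForm m M) : Prop :=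
  ∀ x : M, (G.V 1 x : Set (Big m x)) = Set.range (fun X : Tan m x ↦ (X, flatPM 1 γ ψ x X)) ∧
    (G.V (-1) x : Set (Big m x)) = Set.range (fun X : Tan m x ↦ (X, flatPM (-1) γ ψ x X))

/-- The connections `D^±_X Y = D_X Y ± (1/2) ♯_γ [i(Y) i(X) dψ]` (`s = 1` and `s = -1`);
`connPM s γ ψ Y x v` is `(D^s_v Y)(x)`. -/
def connPM (s : ℝ) (γ : RMetric m M) (ψ : TwoForm m M) (Y : Π x : M, Tan m x) (x : M)
    (v : Tan m x) : Tan m x :=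
  leviCivita γ Y x v + (s / 2) • sharp γ x (interior₃ v (Y x) (ψ.d x))

/-- The vector field `τ_± (S_±)`, where `S_± = (1/2)(Id ± φ) S` is the `V_±`-component of `S` and
`τ_± : V_± → TM` is the projection. -/
def GenMetric.comp (G : GenMetric m M) (s : ℝ) (S : Π x : M, Big m x) (x : M) : Tan m x :=
  ((1 / 2 : ℝ) • (S x + s • G.φ x (S x))).1

/-- The canonical big connection of `G ↔ (γ, ψ)`: the connection on the big tangent bundle with
`∇_X (Y, ♭_{ψ ± γ} Y) = (D^±_X Y, ♭_{ψ ± γ} D^±_X Y)`. -/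
def GenMetric.nabla (G : GenMetric m M) (γ : RMetric m M) (ψ : TwoForm m M)
    (S : Π x : M, Big m x) (x : M) (v : Tan m x) : Big m x :=
  (connPM 1 γ ψ (G.comp 1 S) x v, flatPM 1 γ ψ x (connPM 1 γ ψ (G.comp 1 S) x v)) +
  (connPM (-1) γ ψ (G.comp (-1) S) x v,
    flatPM (-1) γ ψ x (connPM (-1) γ ψ (G.comp (-1) S) x v))

/-! ### Dirac structures -/

/-- An almost Dirac structure: a `C^∞` subbundle of the big tangent bundle that is maximal
isotropic for the neutral metric, i.e. isotropic of rank `m`. -/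
structure AlmostDirac (m : ℕ) (M : Type*) [TopologicalSpace M]
    [ChartedSpace (EuclideanSpace ℝ (Fin m)) M] [IsManifold (𝓡 m) ∞ M] where
  /-- the fibres -/
  fib (x : M) : Submodule ℝ (Big m x)
  isotropic (x : M) (u : Big m x) (hu : u ∈ fib x) (v : Big m x) (hv : v ∈ fib x) :
    neutral u v = 0
  rank (x : M) : finrank ℝ (fib x) = m
  smooth (x₀ : M) : ∃ U : Set M, IsOpen U ∧ x₀ ∈ U ∧ ∃ e : Fin m → Π x : M, Big m x,
    (∀ i, SmoothBigOn U (e i)) ∧ ∀ x ∈ U, fib x = Submodule.span ℝ (Set.range (fun i ↦ e i x))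

namespace AlmostDirac

/-- `S` is a global `C^∞` section of `E`. -/
def IsSection (E : AlmostDirac m M) (S : Π x : M, Big m x) : Prop :=
  SmoothBig S ∧ ∀ x, S x ∈ E.fib x

/-- `E` is a Dirac structure: its sections are closed under the Courant bracket. -/
def IsDirac (E : AlmostDirac m M) : Prop :=
  ∀ S T : Π x : M, Big m x, E.IsSection S → E.IsSection T → ∀ x, courant S T x ∈ E.fib x

/-- The canonical big connection preserves `E`: `∇_X S ∈ ΓE` for every vector field `X` and every
`S ∈ ΓE`. -/
def IsPreserved (E : AlmostDirac m M) (G : GenMetric m M) (γ : RMetric m M) (ψ : TwoForm m M) :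
    Prop :=
  ∀ S : Π x : M, Big m x, E.IsSection S → ∀ (x : M) (v : Tan m x), G.nabla γ ψ S x v ∈ E.fib x

/-- `E` is a parallel Dirac structure on `(M, G)`. -/
def IsParallelDirac (E : AlmostDirac m M) (G : GenMetric m M) (γ : RMetric m M)
    (ψ : TwoForm m M) : Prop := E.IsDirac ∧ E.IsPreserved G γ ψ

theorem isCompl (E : AlmostDirac m M) (G : GenMetric m M) (x : M) :
    IsCompl (E.fib x) ((E.fib x).map (G.φ x)) := by
  have hinj : Function.Injective (G.φ x) := fun u v h ↦ by
    rw [← G.invol x u, h, G.invol]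
  refine (Submodule.isCompl_iff_disjoint _ _ ?_).mpr ?_
  · rw [finrank_big, (Submodule.equivMapOfInjective (G.φ x) hinj (E.fib x)).finrank_eq.symm, E.rank]
  · rw [Submodule.disjoint_def]
    rintro u hu ⟨w, hw, rfl⟩
    by_contra hne
    have h := G.pos x _ hne
    rw [G.invol, E.isotropic x _ hw _ hu] at h
    exact lt_irrefl _ h

/-- The generalized paracomplex structure `Ψ_E` with `+1`-eigenbundle `E` and `-1`-eigenbundle
`φ(E)`. -/
def para (E : AlmostDirac m M) (G : GenMetric m M) (x : M) : Big m x →ₗ[ℝ] Big m x :=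
  (E.fib x).projection _ (E.isCompl G x) -
    ((E.fib x).map (G.φ x)).projection _ (E.isCompl G x).symm

/-- The isometry `F_E` of `(TM, γ)` representing `E`: the tangent component of
`Ψ_E (X, ♭_{ψ + γ} X)`, so that `Ψ_E (X, ♭_{ψ + γ} X) = (F_E X, ♭_{ψ - γ} F_E X)`. -/
def F (E : AlmostDirac m M) (G : GenMetric m M) (γ : RMetric m M) (ψ : TwoForm m M) (x : M) :
    Tan m x →ₗ[ℝ] Tan m x :=
  LinearMap.fst ℝ _ _ ∘ₗ E.para G x ∘ₗ
    LinearMap.prod LinearMap.id (flatPM 1 γ ψ x : Tan m x →ₗ[ℝ] (Tan m x →L[ℝ] ℝ))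

end AlmostDirac

/-- `(D_X F) Y = D_X (F Y) - F (D_X Y)`, with `D` the Levi-Civita connection of `γ`. -/
def covDerivEnd (γ : RMetric m M) (F : Π x : M, Tan m x →ₗ[ℝ] Tan m x)
    (X Y : Π x : M, Tan m x) (x : M) : Tan m x :=
  leviCivita γ (fun y ↦ F y (Y y)) x (X x) - F x (leviCivita γ Y x (X x))

end geometry

end GenRiem

end

/-! Via `V_± ≅ TM`, the subbundle `E` is the graph of `F_E`: its vectors are those of `V_+ ⊕ V_-`
with components `(Y, F_E Y)`. Hence `∇` preserves `E` iff `D⁻ ∘ F_E = F_E ∘ D⁺`, which is the first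
identity. As `E` is maximal isotropic, its sections are closed under the Courant bracket iff the
Courant tensor `g([S, T], R)` vanishes on them. The B-field transform `e^ψ` reduces this tensor to
the case `ψ = 0` at the cost of a term `dψ`; there, since `D` is metric and torsion free, it is
`-2` times the cyclic sum of the `γ(F_E Z, (D_X F_E) Y)`. Inserting the first identity, everything
collapses to `-2 (dψ + F_E^* dψ)`.
-/

namespace GenRiem

open Bundle VectorField Module
open scoped Topology

/-! ### Exterior derivatives of forms and smoothness of sections -/

section AlternatingMap

theorem alternatingMap_rotate {R A B : Type*} [Ring R] [AddCommGroup A] [Module R A]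
    [AddCommGroup B] [Module R B] (η : A [⋀^Fin 3]→ₗ[R] B) (a b c : A) :
    η ![a, b, c] = η ![b, c, a] := by
  have h := η.map_perm ![a, b, c] (finRotate 3)
  have hperm : (![a, b, c] ∘ finRotate 3 : Fin 3 → A) = ![b, c, a] := by
    ext1 i; fin_cases i <;> rfl
  rwa [hperm, show Equiv.Perm.sign (finRotate 3) = 1 by decide, one_smul, eq_comm] at h

theorem alternatingMap_add_sub_cyclic {R A B : Type*} [Ring R] [AddCommGroup A] [Module R A]
    [AddCommGroup B] [Module R B] (η : A [⋀^Fin 3]→ₗ[R] B) (a₁ a₂ a₃ b₁ b₂ b₃ : A) :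
    η ![a₁ + b₁, a₂ + b₂, a₃ + b₃]
      - ((η ![a₁ + b₁, a₂, a₃] + η ![a₁ + b₁, b₂, b₃])
        + (η ![a₂ + b₂, a₃, a₁] + η ![a₂ + b₂, b₃, b₁])
        + (η ![a₃ + b₃, a₁, a₂] + η ![a₃ + b₃, b₁, b₂])) =
    -2 • (η ![a₁, a₂, a₃] + η ![b₁, b₂, b₃]) := by
  have add_fst (u v c d : A) : η ![u + v, c, d] = η ![u, c, d] + η ![v, c, d] :=
    η.map_vecCons_add _ u v
  have add_snd (c u v d : A) : η ![c, u + v, d] = η ![c, u, d] + η ![c, v, d] := by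
    simp only [alternatingMap_rotate η c, add_fst]
  have add_thd (c d u v : A) : η ![c, d, u + v] = η ![c, d, u] + η ![c, d, v] := by
    simp only [← alternatingMap_rotate η _ c d, add_fst]
  simp only [add_fst, add_snd, add_thd]
  rw [alternatingMap_rotate η a₃ a₁ a₂, alternatingMap_rotate η b₃ a₁ a₂,
    alternatingMap_rotate η a₃ b₁ b₂, alternatingMap_rotate η b₃ b₁ b₂,
    ← alternatingMap_rotate η a₁ a₂ a₃, ← alternatingMap_rotate η a₁ b₂ a₃,
    ← alternatingMap_rotate η b₁ a₂ b₃, ← alternatingMap_rotate η b₁ b₂ b₃]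
  abel

variable {𝕜 : Type*} [NontriviallyNormedField 𝕜] [CompleteSpace 𝕜]

theorem differentiableWithinAt_of_alternatingMap_apply {H E F ι : Type*} [Finite ι]
    [NormedAddCommGroup H] [NormedSpace 𝕜 H]
    [NormedAddCommGroup E] [NormedSpace 𝕜 E] [FiniteDimensional 𝕜 E]
    [NormedAddCommGroup F] [NormedSpace 𝕜 F] [FiniteDimensional 𝕜 F]
    {θ : H → E [⋀^ι]→L[𝕜] F} {s : Set H} {y : H}
    (h : ∀ v : ι → E, DifferentiableWithinAt 𝕜 (fun z ↦ θ z v) s y) :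
    DifferentiableWithinAt 𝕜 θ s y := by
  classical
  have := Fintype.ofFinite ι
  let b := finBasis 𝕜 E
  let evalBasis : (E [⋀^ι]→L[𝕜] F) →ₗ[𝕜] ((ι → Fin (finrank 𝕜 E)) → F) :=
    { toFun := fun η f ↦ η fun i ↦ b (f i)
      map_add' := fun _ _ ↦ rfl
      map_smul' := fun _ _ ↦ rfl }
  have hinj : Function.Injective evalBasis := fun η ζ hηζ ↦
    ContinuousAlternatingMap.toAlternatingMap_injective <|
      Basis.ext_alternating b fun f _ ↦ congrFun hηζ f
  obtain ⟨R, hR⟩ := evalBasis.exists_leftInverse_of_injective (LinearMap.ker_eq_bot.mpr hinj)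
  have hθ : θ = fun z ↦ LinearMap.toContinuousLinearMap R (evalBasis (θ z)) :=
    funext fun z ↦ (LinearMap.congr_fun hR (θ z)).symm
  rw [hθ]
  exact (LinearMap.toContinuousLinearMap R).differentiableAt.comp_differentiableWithinAt y
    (differentiableWithinAt_pi.mpr fun f ↦ h _)

end AlternatingMap

section ExteriorDerivative

variable {𝕜 : Type*} [NontriviallyNormedField 𝕜]
  {E : Type*} [NormedAddCommGroup E] [NormedSpace 𝕜 E]
  {F : Type*} [NormedAddCommGroup F] [NormedSpace 𝕜 F]
  {H : Type*} [TopologicalSpace H] (I : ModelWithCorners 𝕜 E H)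
  {M : Type*} [TopologicalSpace M] [ChartedSpace H M] {n : ℕ}

/-- A vector field read in the preferred chart at `x`, which turns manifold Lie brackets into those
of the model space. -/
noncomputable def chartVF (x : M) (X : Π x : M, TangentSpace I x) : E → E :=
  mpullbackWithin 𝓘(𝕜, E) I (extChartAt I x).symm X (Set.range I)

/-- A form read in the preferred chart at `x`, where its exterior derivative is computed. -/
noncomputable def chartForm (x : M) (θ : Π x : M, TangentSpace I x [⋀^Fin n]→L[𝕜] F) :
    E → E [⋀^Fin n]→L[𝕜] F := fun y ↦
  (θ ((extChartAt I x).symm y)).compContinuousLinearMap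
    (mfderivWithin 𝓘(𝕜, E) I (extChartAt I x).symm (Set.range I) y)

variable [IsManifold I 1 M]

/-- Differentiability of a form at `x`, tested on vector fields so as to avoid a topology on the
bundle of alternating maps. -/
def DiffForm (θ : Π x : M, TangentSpace I x [⋀^Fin n]→L[𝕜] F) (x : M) : Prop :=
  ∀ V : Fin n → Π x : M, TangentSpace I x, (∀ i, MDiffAt (T% (V i)) x) →
    MDiffAt (fun y ↦ θ y (V · y)) x

variable {I}

theorem chartVF_self (x : M) (X : Π x : M, TangentSpace I x) :
    chartVF I x X (extChartAt I x x) = X x := by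
  have hX : ∀ z : M, z = x → (X z : E) = X x := by rintro z rfl; rfl
  exact (mfderivWithin_extChartAt_symm_inverse_apply (I := I) (x := x) _).trans
    (hX _ (extChartAt_to_inv x))

theorem chartForm_chartVF (x : M) (θ : Π x : M, TangentSpace I x [⋀^Fin n]→L[𝕜] F)
    (X : Fin n → Π x : M, TangentSpace I x) {y : E} (hy : y ∈ (extChartAt I x).target) :
    chartForm I x θ y (fun i ↦ chartVF I x (X i) y) =
      θ ((extChartAt I x).symm y) (fun i ↦ X i ((extChartAt I x).symm y)) := by
  have h := isInvertible_mfderivWithin_extChartAt_symm (I := I) hy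
  refine congrArg (θ ((extChartAt I x).symm y)) (funext fun i ↦ ?_)
  exact (h.inverse_apply_eq.mp rfl).symm

theorem chartForm_self (x : M) (θ : Π x : M, TangentSpace I x [⋀^Fin n]→L[𝕜] F)
    (v : Fin n → TangentSpace I x) : chartForm I x θ (extChartAt I x x) v = θ x v := by
  have h := chartForm_chartVF x θ (fun i ↦ FiberBundle.extend E (x := x) (v i))
    (mem_extChartAt_target x)
  rw [extChartAt_to_inv] at h
  simpa only [chartVF_self, FiberBundle.extend_apply_self] using h

theorem trivializationAt_self_apply (x : M) (v : TangentSpace I x) :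
    (trivializationAt E (TangentSpace I) x ⟨x, v⟩).2 = v := by
  have h := DFunLike.congr_fun (TangentBundle.continuousLinearMapAt_trivializationAt (𝕜 := 𝕜)
    (I := I) (mem_chart_source H x)) v
  rwa [mfderiv_extChartAt_self, Trivialization.continuousLinearMapAt_apply,
    Trivialization.coe_linearMapAt_of_mem _ (FiberBundle.mem_baseSet_trivializationAt' x)] at h

theorem chartVF_extend (x : M) (v : TangentSpace I x) :
    ∀ᶠ y in 𝓝[Set.range I] (extChartAt I x x), chartVF I x (FiberBundle.extend E v) y = v := by
  filter_upwards [extChartAt_target_mem_nhdsWithin x] with y hy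
  have hz : (extChartAt I x).symm y ∈ (chartAt H x).source := by
    rw [← extChartAt_source I]
    exact (extChartAt I x).map_target hy
  have hL := TangentBundle.symmL_trivializationAt (𝕜 := 𝕜) (I := I) hz
  rw [(extChartAt I x).right_inv hy] at hL
  refine (isInvertible_mfderivWithin_extChartAt_symm hy).inverse_apply_eq.mpr ?_
  rw [← hL]
  have hv := congrArg (Trivialization.symmL 𝕜 (trivializationAt E (TangentSpace I) x)
    ((extChartAt I x).symm y)) (trivializationAt_self_apply x v)
  exact (Trivialization.symmL_apply (R := 𝕜) _ hz _).symm.trans hv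

theorem differentiableWithinAt_chartVF [IsManifold I 2 M] [CompleteSpace E] {x : M}
    {X : Π x : M, TangentSpace I x} (hX : MDiffAt (T% X) x) :
    DifferentiableWithinAt 𝕜 (chartVF I x X) (Set.range I) (extChartAt I x x) := by
  have h := (mdifferentiableWithinAt_univ.mpr hX)
    |>.differentiableWithinAt_mpullbackWithin_vectorField
  rwa [Set.preimage_univ, Set.univ_inter] at h

theorem mvfderiv_alternatingMap_apply {x : M}
    {θ : Π x : M, TangentSpace I x [⋀^Fin n]→L[𝕜] F} (hθ : DiffForm I θ x)
    {X : Fin n → Π x : M, TangentSpace I x} (hX : ∀ i, MDiffAt (T% (X i)) x) :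
    mvfderiv I (fun y ↦ θ y (X · y)) x =
      fderivWithin 𝕜 (fun y ↦ chartForm I x θ y fun i ↦ chartVF I x (X i) y) (Set.range I)
        (extChartAt I x x) := by
  refine (hθ X hX).mvfderiv.trans <|
    (Filter.EventuallyEq.fderivWithin_eq_of_mem ?_ (Set.mem_range_self _)).symm
  filter_upwards [extChartAt_target_mem_nhdsWithin x] with y hy
  exact chartForm_chartVF x θ X hy

theorem mlieBracket_eq_chartVF (X Y : Π x : M, TangentSpace I x) (x : M) :
    mlieBracket I X Y x =
      lieBracketWithin 𝕜 (chartVF I x X) (chartVF I x Y) (Set.range I) (extChartAt I x x) := by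
  rw [← mlieBracketWithin_univ, mlieBracketWithin_apply, mfderiv_extChartAt_self,
    Set.preimage_univ, Set.univ_inter]
  exact DFunLike.congr_fun ContinuousLinearMap.inverse_id _

variable [CompleteSpace 𝕜] [FiniteDimensional 𝕜 E] [FiniteDimensional 𝕜 F]

theorem differentiableWithinAt_chartForm {x : M}
    {θ : Π x : M, TangentSpace I x [⋀^Fin n]→L[𝕜] F} (hθ : DiffForm I θ x) :
    DifferentiableWithinAt 𝕜 (chartForm I x θ) (Set.range I) (extChartAt I x x) := by
  refine differentiableWithinAt_of_alternatingMap_apply fun v ↦ ?_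
  let X : Fin n → Π y : M, TangentSpace I y := fun i ↦ FiberBundle.extend E (x := x) (v i)
  have hX := mdifferentiableWithinAt_univ.mpr
    (hθ X fun i ↦ FiberBundle.mdifferentiableAt_extend ..)
    |>.differentiableWithinAt_comp_extChartAt_symm
  rw [Set.preimage_univ, Set.univ_inter] at hX
  refine hX.congr_of_eventuallyEq_of_mem ?_ (Set.mem_range_self _)
  filter_upwards [extChartAt_target_mem_nhdsWithin x,
    Filter.eventually_all.mpr fun i ↦ chartVF_extend x (v i)] with y hy hv
  refine Eq.trans ?_ (chartForm_chartVF x θ X hy)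
  exact congrArg (chartForm I x θ y) (funext fun i ↦ (hv i).symm)

theorem extDerivWithin_chartForm_apply [IsManifold I 2 M] {x : M}
    {θ : Π x : M, TangentSpace I x [⋀^Fin (n + 1)]→L[𝕜] F} (hθ : DiffForm I θ x)
    {X : Fin (n + 2) → Π x : M, TangentSpace I x} (hX : ∀ i, MDiffAt (T% (X i)) x) :
    extDerivWithin (chartForm I x θ) (Set.range I) (extChartAt I x x) (X · x) =
      (∑ i, (-1) ^ i.val • mvfderiv I (fun y ↦ θ y (i.removeNth (X · y))) x (X i x)) -
        ∑ i : Fin (n + 1), ∑ j ≥ i, (-1) ^ (i + j : ℕ) •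
          θ x (Matrix.vecCons (mlieBracket I (X i.castSucc) (X j.succ) x)
            (j.removeNth <| i.castSucc.removeNth (X · x))) := by
  have := FiniteDimensional.complete 𝕜 E
  have hchart := extDerivWithin_apply_vectorField (differentiableWithinAt_chartForm hθ)
    (fun i ↦ differentiableWithinAt_chartVF (hX i)) (I.uniqueDiffOn _ (Set.mem_range_self _))
  simp only [chartVF_self] at hchart
  refine hchart.trans (congrArg₂ (· - ·) ?_ ?_)
  · refine Finset.sum_congr rfl fun i _ ↦ congrArg _ ?_
    exact (DFunLike.congr_fun (mvfderiv_alternatingMap_apply hθ fun j ↦ hX (i.succAbove j)) _).symm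
  · refine Finset.sum_congr rfl fun i _ ↦ Finset.sum_congr rfl fun j _ ↦ congrArg _ ?_
    rw [mlieBracket_eq_chartVF]
    exact chartForm_self x θ _

end ExteriorDerivative

section Smoothness

variable {𝕜 : Type*} [NontriviallyNormedField 𝕜]
  {E : Type*} [NormedAddCommGroup E] [NormedSpace 𝕜 E]
  {H : Type*} [TopologicalSpace H] {I : ModelWithCorners 𝕜 E H}
  {M : Type*} [TopologicalSpace M] [ChartedSpace H M] {n : WithTop ℕ∞} {x₀ : M}

theorem contMDiffAt_of_clm_apply {F F' : Type*} [NormedAddCommGroup F] [NormedSpace 𝕜 F]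
    [CompleteSpace F] [NormedAddCommGroup F'] [NormedSpace 𝕜 F'] {A : M → F →L[𝕜] F'} {w : M → F}
    (hA : ContMDiffAt I 𝓘(𝕜, F →L[𝕜] F') n A x₀) (hinv : (A x₀).HasLeftInverse)
    (h : ContMDiffAt I 𝓘(𝕜, F') n (fun x ↦ A x (w x)) x₀) : ContMDiffAt I 𝓘(𝕜, F) n w x₀ := by
  let R := hinv.leftInverse
  let B : M → F →L[𝕜] F := fun x ↦ R ∘L A x
  have hB : ContMDiffAt I 𝓘(𝕜, F →L[𝕜] F) n B x₀ := contMDiffAt_const.clm_comp hA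
  have hB₀ : B x₀ = ContinuousLinearEquiv.refl 𝕜 F :=
    ContinuousLinearMap.ext hinv.leftInverse_leftInverse
  have hinvertible : ∀ᶠ x in 𝓝 x₀, (B x).IsInvertible :=
    hB.continuousAt (hB₀ ▸ (ContinuousLinearEquiv.refl 𝕜 F).nhds)
  have hBinv : ContMDiffAt I 𝓘(𝕜, F →L[𝕜] F) n (fun x ↦ (B x).inverse) x₀ :=
    (hB₀ ▸ contDiffAt_map_inverse _ : ContDiffAt 𝕜 n ContinuousLinearMap.inverse (B x₀))
      |>.contMDiffAt.comp x₀ hB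
  have hRA : ContMDiffAt I 𝓘(𝕜, F) n (fun x ↦ B x (w x)) x₀ := contMDiffAt_const.clm_apply h
  refine (hBinv.clm_apply hRA).congr_of_eventuallyEq ?_
  filter_upwards [hinvertible] with x hx
  exact (hx.inverse_apply_eq.mpr rfl).symm

variable {F : Type*} [NormedAddCommGroup F] [NormedSpace 𝕜 F]
  {V : M → Type*} [TopologicalSpace (TotalSpace F V)] [∀ x, AddCommGroup (V x)]
  [∀ x, Module 𝕜 (V x)] [∀ x, TopologicalSpace (V x)] [FiberBundle F V] [VectorBundle 𝕜 F V]

theorem contMDiffAt_coeff_of_linearIndependent [CompleteSpace 𝕜] [FiniteDimensional 𝕜 F]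
    {ι : Type*} [Fintype ι] {a : ι → Π x, V x} {c : M → ι → 𝕜}
    (ha : ∀ j, ContMDiffAt I (I.prod 𝓘(𝕜, F)) n (fun x ↦ TotalSpace.mk' F x (a j x)) x₀)
    (hli : LinearIndependent 𝕜 (a · x₀))
    (h : ContMDiffAt I (I.prod 𝓘(𝕜, F)) n
      (fun x ↦ TotalSpace.mk' F x (∑ j, c x j • a j x)) x₀) :
    ContMDiffAt I 𝓘(𝕜, ι → 𝕜) n c x₀ := by
  let e := trivializationAt F V x₀
  have hx₀ : x₀ ∈ e.baseSet := FiberBundle.mem_baseSet_trivializationAt' x₀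
  let A : M → (ι → 𝕜) →L[𝕜] F := fun x ↦
    ∑ j, (ContinuousLinearMap.proj j).smulRight (e ⟨x, a j x⟩).2
  have hA_apply {x : M} (hx : x ∈ e.baseSet) (k : ι → 𝕜) :
      A x k = e.continuousLinearMapAt 𝕜 x (∑ j, k j • a j x) := by
    simp [A, e.coe_linearMapAt_of_mem hx]
  have hA : ContMDiffAt I 𝓘(𝕜, (ι → 𝕜) →L[𝕜] F) n A x₀ := contMDiffAt_finsetSum fun j _ ↦
    (ContinuousLinearMap.smulRightL 𝕜 (ι → 𝕜) F (ContinuousLinearMap.proj j)).contMDiff.contMDiffAt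
      |>.comp x₀ ((contMDiffAt_section x₀).mp (ha j))
  have hinj : Function.Injective (A x₀) := by
    rw [injective_iff_map_eq_zero]
    intro k hk
    rw [hA_apply hx₀] at hk
    refine funext (Fintype.linearIndependent_iff.mp hli k ?_)
    have := congrArg (e.symmL 𝕜 x₀) hk
    rwa [e.symmL_continuousLinearMapAt hx₀, map_zero] at this
  refine contMDiffAt_of_clm_apply hA (.of_injective_of_finiteDimensional hinj) ?_
  refine ((contMDiffAt_section x₀).mp h).congr_of_eventuallyEq ?_
  filter_upwards [e.open_baseSet.mem_nhds hx₀] with x hx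
  rw [hA_apply hx, e.continuousLinearMapAt_apply 𝕜, e.coe_linearMapAt_of_mem hx]

end Smoothness

section Bump

variable {E : Type*} [NormedAddCommGroup E] [NormedSpace ℝ E] [FiniteDimensional ℝ E]
  {H : Type*} [TopologicalSpace H] (I : ModelWithCorners ℝ E H)
  {M : Type*} [TopologicalSpace M] [T2Space M] [ChartedSpace H M] [IsManifold I ∞ M]

theorem exists_contMDiff_tsupport_subset {U : Set M} {x : M} (hU : U ∈ 𝓝 x) :
    ∃ f : M → ℝ, ContMDiff I 𝓘(ℝ) ∞ f ∧ f x = 1 ∧ tsupport f ⊆ U := by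
  obtain ⟨f, -, hf⟩ := (SmoothBumpFunction.nhds_basis_tsupport (I := I) x).mem_iff.mp hU
  exact ⟨f, f.contMDiff, f.eq_one, hf⟩

theorem exists_contMDiff_section_eq {F : Type*} [NormedAddCommGroup F] [NormedSpace ℝ F]
    {V : M → Type*} [TopologicalSpace (TotalSpace F V)] [∀ x, AddCommGroup (V x)]
    [∀ x, Module ℝ (V x)] [∀ x, TopologicalSpace (V x)] [FiberBundle F V] [VectorBundle ℝ F V]
    [ContMDiffVectorBundle ∞ F V I] {x : M} (v : V x) :
    ∃ s : Π x, V x, ContMDiff I (I.prod 𝓘(ℝ, F)) ∞ (fun y ↦ TotalSpace.mk' F y (s y)) ∧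
      s x = v := by
  obtain ⟨U, hU, hs⟩ := FiberBundle.exists_contMDiffOn_extend (k := ∞) I F v
  obtain ⟨f, hf, hfx, hfU⟩ := exists_contMDiff_tsupport_subset I (interior_mem_nhds.mpr hU)
  refine ⟨f • FiberBundle.extend F v, ContMDiffOn.smul_section_of_tsupport hf.contMDiffOn
    isOpen_interior hfU (hs.mono interior_subset), ?_⟩
  rw [Pi.smul_apply', hfx, one_smul, FiberBundle.extend_apply_self]

end Bump

variable {m : ℕ} {M : Type*} [TopologicalSpace M] [ChartedSpace (EuclideanSpace ℝ (Fin m)) M]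
  [IsManifold (𝓡 m) ∞ M]

theorem extD_apply {n : ℕ} {θ : Π x : M, Tan m x [⋀^Fin (n + 1)]→L[ℝ] ℝ} {x : M}
    (hθ : DiffForm (𝓡 m) θ x) {X : Fin (n + 2) → Π x : M, Tan m x} (hX : ∀ i, DiffVF (X i) x) :
    extD θ x (X · x) =
      (∑ i, (-1) ^ i.val • mvfderiv (𝓡 m) (fun y ↦ θ y (i.removeNth (X · y))) x (X i x)) -
        ∑ i : Fin (n + 1), ∑ j ≥ i, (-1) ^ (i + j : ℕ) •
          θ x (Matrix.vecCons (mlieBracket (𝓡 m) (X i.castSucc) (X j.succ) x)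
            (j.removeNth <| i.castSucc.removeNth (X · x))) := by
  unfold extD
  rw [mfderiv_extChartAt_self]
  exact extDerivWithin_chartForm_apply hθ hX

/-- Differentiability of a one-form at `x`, as a section of the cotangent bundle; the counterpart
of `DiffVF`. -/
def DiffOneForm (μ : Π x : M, Tan m x →L[ℝ] ℝ) (x : M) : Prop :=
  MDifferentiableAt (𝓡 m) ((𝓡 m).prod 𝓘(ℝ, EuclideanSpace ℝ (Fin m) →L[ℝ] ℝ))
    (fun y ↦ TotalSpace.mk' (EuclideanSpace ℝ (Fin m) →L[ℝ] ℝ)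
      (E := fun x : M ↦ Tan m x →L[ℝ] ℝ) y (μ y)) x

theorem DiffOneForm.apply {μ : Π x : M, Tan m x →L[ℝ] ℝ} {x : M} (hμ : DiffOneForm μ x)
    {X : Π x : M, Tan m x} (hX : DiffVF X x) :
    MDifferentiableAt (𝓡 m) 𝓘(ℝ) (fun y ↦ μ y (X y)) x := by
  have h := MDifferentiableAt.clm_bundle_apply (F₁ := EuclideanSpace ℝ (Fin m))
    (E₁ := fun x : M ↦ Tan m x) (F₂ := ℝ) (E₂ := Bundle.Trivial M ℝ) (b := id) hμ hX
  exact ((mdifferentiableAt_totalSpace _ _).mp h).2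

theorem extD_oneForm {μ : Π x : M, Tan m x →L[ℝ] ℝ} {x : M} (hμ : DiffOneForm μ x)
    {X Y : Π x : M, Tan m x} (hX : DiffVF X x) (hY : DiffVF Y x) :
    extD (oneFormAlt μ) x ![X x, Y x] =
      mvfderiv (𝓡 m) (fun y ↦ μ y (Y y)) x (X x) - mvfderiv (𝓡 m) (fun y ↦ μ y (X y)) x (Y x)
        - μ x (mlieBracket (𝓡 m) X Y x) := by
  have h := extD_apply (θ := oneFormAlt μ) (fun V hV ↦ hμ.apply (hV 0)) (X := ![X, Y])
    (fun i ↦ by fin_cases i <;> assumption)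
  have hXY : (fun i ↦ (![X, Y] : Fin 2 → Π x : M, Tan m x) i x) = ![X x, Y x] := by
    ext1 i; fin_cases i <;> rfl
  rw [hXY, Fin.sum_univ_two, Fin.sum_univ_one, (by decide : Finset.Ici (0 : Fin 1) = {0}),
    Finset.sum_singleton] at h
  refine h.trans ?_
  change ((1 : ℤ) • mvfderiv (𝓡 m) (fun y ↦ μ y (Y y)) x (X x) +
    (-1 : ℤ) • mvfderiv (𝓡 m) (fun y ↦ μ y (X y)) x (Y x)) -
    (1 : ℤ) • μ x (mlieBracket (𝓡 m) X Y x) = _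
  module

theorem TwoForm.mdifferentiableAt_apply (ψ : TwoForm m M) {X Y : Π x : M, Tan m x} {x : M}
    (hX : DiffVF X x) (hY : DiffVF Y x) :
    MDifferentiableAt (𝓡 m) 𝓘(ℝ) (fun y ↦ ψ.form y (X y) (Y y)) x := by
  have h := MDifferentiableAt.clm_bundle_apply₂ (F₁ := EuclideanSpace ℝ (Fin m))
    (E₁ := fun x : M ↦ Tan m x) (F₂ := EuclideanSpace ℝ (Fin m))
    (E₂ := fun x : M ↦ Tan m x) (F₃ := ℝ) (E₃ := Bundle.Trivial M ℝ) (b := id)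
    (ψ.contMDiff.contMDiffAt.mdifferentiableAt (by simp)) hX hY
  exact ((mdifferentiableAt_totalSpace _ _).mp h).2

theorem TwoForm.d_apply (ψ : TwoForm m M) {X Y Z : Π x : M, Tan m x} {x : M}
    (hX : DiffVF X x) (hY : DiffVF Y x) (hZ : DiffVF Z x) :
    ψ.d x ![X x, Y x, Z x] =
      mvfderiv (𝓡 m) (fun y ↦ ψ.form y (Y y) (Z y)) x (X x)
        - mvfderiv (𝓡 m) (fun y ↦ ψ.form y (X y) (Z y)) x (Y x)
        + mvfderiv (𝓡 m) (fun y ↦ ψ.form y (X y) (Y y)) x (Z x)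
        - ψ.form x (mlieBracket (𝓡 m) X Y x) (Z x)
        + ψ.form x (mlieBracket (𝓡 m) X Z x) (Y x)
        - ψ.form x (mlieBracket (𝓡 m) Y Z x) (X x) := by
  have h := extD_apply (θ := ψ.toAlt) (fun V hV ↦ ψ.mdifferentiableAt_apply (hV 0) (hV 1))
    (X := ![X, Y, Z]) (fun i ↦ by fin_cases i <;> assumption)
  have hXYZ : (fun i ↦ (![X, Y, Z] : Fin 3 → Π x : M, Tan m x) i x) = ![X x, Y x, Z x] := by
    ext1 i; fin_cases i <;> rfl
  rw [hXYZ, Fin.sum_univ_three, Fin.sum_univ_two, (by decide : Finset.Ici (0 : Fin 2) = {0, 1}),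
    (by decide : Finset.Ici (1 : Fin 2) = {1}), Finset.sum_singleton,
    Finset.sum_pair (by decide)] at h
  refine h.trans ?_
  change ((1 : ℤ) • mvfderiv (𝓡 m) (fun y ↦ ψ.form y (Y y) (Z y)) x (X x) +
    (-1 : ℤ) • mvfderiv (𝓡 m) (fun y ↦ ψ.form y (X y) (Z y)) x (Y x) +
    (1 : ℤ) • mvfderiv (𝓡 m) (fun y ↦ ψ.form y (X y) (Y y)) x (Z x)) -
    ((1 : ℤ) • ψ.form x (mlieBracket (𝓡 m) X Y x) (Z x) +
      (-1 : ℤ) • ψ.form x (mlieBracket (𝓡 m) X Z x) (Y x) +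
      (1 : ℤ) • ψ.form x (mlieBracket (𝓡 m) Y Z x) (X x)) = _
  module

/-! ### The Courant bracket and the Levi-Civita connection -/

theorem inner_leviCivita (γ : RMetric m M) {X Y Z : Π x : M, Tan m x} {x : M}
    (hX : DiffVF X x) (hY : DiffVF Y x) (hZ : DiffVF Z x) :
    γ.inner x (leviCivita γ Y x (X x)) (Z x) = koszul γ X Y Z x := by
  rw [← koszulForm_apply γ hX hY hZ]
  exact inner_sharp γ x _ _

theorem inner_mlieBracket_swap (γ : RMetric m M) (X Y : Π x : M, Tan m x) (x : M) (z : Tan m x) :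
    γ.inner x (mlieBracket (𝓡 m) X Y x) z = - γ.inner x (mlieBracket (𝓡 m) Y X x) z := by
  rw [mlieBracket_swap_apply, map_neg]
  rfl

theorem mvfderiv_pair (γ : RMetric m M) {Y Z : Π x : M, Tan m x} {x : M}
    (hY : DiffVF Y x) (hZ : DiffVF Z x) (v : Tan m x) :
    mvfderiv (𝓡 m) (pair γ Y Z) x v =
      γ.inner x (leviCivita γ Y x v) (Z x) + γ.inner x (Y x) (leviCivita γ Z x v) := by
  obtain ⟨X, hX, rfl⟩ := exists_diffVF v
  rw [γ.symm x (Y x), inner_leviCivita γ hX hY hZ, inner_leviCivita γ hX hZ hY]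
  unfold koszul
  rw [inner_mlieBracket_swap γ Y Z, pair_comm γ Z Y]
  ring

theorem inner_mlieBracket (γ : RMetric m M) {X Y : Π x : M, Tan m x} {x : M}
    (hX : DiffVF X x) (hY : DiffVF Y x) (z : Tan m x) :
    γ.inner x (mlieBracket (𝓡 m) X Y x) z =
      γ.inner x (leviCivita γ Y x (X x)) z - γ.inner x (leviCivita γ X x (Y x)) z := by
  obtain ⟨Z, hZ, rfl⟩ := exists_diffVF z
  rw [inner_leviCivita γ hX hY hZ, inner_leviCivita γ hY hX hZ]
  unfold koszul
  rw [inner_mlieBracket_swap γ Y X, pair_comm γ Y X]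
  ring

theorem leviCivita_add (γ : RMetric m M) {X Y : Π x : M, Tan m x} {x : M}
    (hX : DiffVF X x) (hY : DiffVF Y x) (v : Tan m x) :
    leviCivita γ (fun y ↦ X y + Y y) x v = leviCivita γ X x v + leviCivita γ Y x v :=
  DFunLike.congr_fun ((leviCivita γ).isCovariantDerivativeOnUniv.add hX hY) v

theorem leviCivita_sub (γ : RMetric m M) {X Y : Π x : M, Tan m x} {x : M}
    (hX : DiffVF X x) (hY : DiffVF Y x) (v : Tan m x) :
    leviCivita γ (fun y ↦ X y - Y y) x v = leviCivita γ X x v - leviCivita γ Y x v := by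
  have h := leviCivita_add γ (X := fun y ↦ X y - Y y) (mdifferentiableAt_sub_section hX hY) hY v
  simp only [sub_add_cancel] at h
  exact eq_sub_of_add_eq h.symm

theorem TwoForm.form_swap (ψ : TwoForm m M) {x : M} (v w : Tan m x) :
    ψ.form x v w = - ψ.form x w v := by
  have h := ψ.alt x (v + w)
  simp only [map_add, add_apply, ψ.alt] at h
  linarith

theorem diffOneForm_clm_apply {A : Π x : M, Tan m x →L[ℝ] Tan m x →L[ℝ] ℝ}
    (hA : ContMDiff (𝓡 m)
      ((𝓡 m).prod 𝓘(ℝ, EuclideanSpace ℝ (Fin m) →L[ℝ] EuclideanSpace ℝ (Fin m) →L[ℝ] ℝ)) ∞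
      (fun x ↦ TotalSpace.mk' (EuclideanSpace ℝ (Fin m) →L[ℝ] EuclideanSpace ℝ (Fin m) →L[ℝ] ℝ)
        (E := fun x : M ↦ Tan m x →L[ℝ] Tan m x →L[ℝ] ℝ) x (A x)))
    {X : Π x : M, Tan m x} {x : M} (hX : DiffVF X x) : DiffOneForm (fun y ↦ A y (X y)) x :=
  MDifferentiableAt.clm_bundle_apply (F₁ := EuclideanSpace ℝ (Fin m))
    (E₁ := fun x : M ↦ Tan m x) (F₂ := EuclideanSpace ℝ (Fin m) →L[ℝ] ℝ)
    (E₂ := fun x : M ↦ Tan m x →L[ℝ] ℝ) (b := id)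
    (hA.contMDiffAt.mdifferentiableAt (by simp)) hX

/-- Differentiability at `x` of a section of the big tangent bundle, componentwise: the regularity
under which the Courant bracket at `x` can be computed. -/
def DiffBig (S : Π x : M, Big m x) (x : M) : Prop :=
  DiffVF (fun y ↦ (S y).1) x ∧ DiffOneForm (fun y ↦ (S y).2) x

theorem neutral_courant {S T R : Π x : M, Big m x} {x : M}
    (hS : DiffBig S x) (hT : DiffBig T x) (hR : DiffVF (fun y ↦ (R y).1) x) :
    neutral (courant S T x) (R x) =
      mvfderiv (𝓡 m) (fun y ↦ (T y).2 (R y).1) x (S x).1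
      - mvfderiv (𝓡 m) (fun y ↦ (S y).2 (R y).1) x (T x).1
      + (1 / 2) * (mvfderiv (𝓡 m) (fun y ↦ (S y).2 (T y).1) x (R x).1
        - mvfderiv (𝓡 m) (fun y ↦ (T y).2 (S y).1) x (R x).1)
      - (T x).2 (mlieBracket (𝓡 m) (fun y ↦ (S y).1) (fun y ↦ (R y).1) x)
      + (S x).2 (mlieBracket (𝓡 m) (fun y ↦ (T y).1) (fun y ↦ (R y).1) x)
      + (R x).2 (mlieBracket (𝓡 m) (fun y ↦ (S y).1) (fun y ↦ (T y).1) x) := by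
  have interior₂_apply (v w : Tan m x) (η : Tan m x [⋀^Fin 2]→L[ℝ] ℝ) :
    interior₂ v η w = η ![v, w] := rfl
  simp only [neutral, courant, lieD, add_apply, sub_apply, smul_apply, smul_eq_mul, interior₂_apply,
    mvfderiv_fun_sub (hS.2.apply hT.1) (hT.2.apply hS.1)]
  rw [extD_oneForm hT.2 hS.1 hR, extD_oneForm hS.2 hT.1 hR]
  ring

/-- The B-field transform `(X, α) ↦ (X, α + ψ(X, ·))`. It identifies the vectors `(X, ♭_{ψ±γ} X)`
with their analogues for `ψ = 0`. -/
noncomputable def bTransform (ψ : TwoForm m M) (S : Π x : M, Big m x) (x : M) : Big m x :=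
  ((S x).1, (S x).2 + ψ.form x (S x).1)

theorem DiffBig.bTransform (ψ : TwoForm m M) {S : Π x : M, Big m x} {x : M} (hS : DiffBig S x) :
    DiffBig (bTransform ψ S) x :=
  ⟨hS.1, mdifferentiableAt_add_section hS.2 (diffOneForm_clm_apply ψ.contMDiff hS.1)⟩

theorem mvfderiv_bTransform (ψ : TwoForm m M) {S : Π x : M, Big m x} {X : Π x : M, Tan m x}
    {x : M} (hS : DiffBig S x) (hX : DiffVF X x) (v : Tan m x) :
    mvfderiv (𝓡 m) (fun y ↦ (bTransform ψ S y).2 (X y)) x v =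
      mvfderiv (𝓡 m) (fun y ↦ (S y).2 (X y)) x v
        + mvfderiv (𝓡 m) (fun y ↦ ψ.form y (S y).1 (X y)) x v :=
  DFunLike.congr_fun
    (mvfderiv_fun_add (hS.2.apply hX) (ψ.mdifferentiableAt_apply hS.1 hX)) v

theorem neutral_courant_bTransform (ψ : TwoForm m M) {S T R : Π x : M, Big m x} {x : M}
    (hS : DiffBig S x) (hT : DiffBig T x) (hR : DiffVF (fun y ↦ (R y).1) x) :
    neutral (courant (bTransform ψ S) (bTransform ψ T) x) (bTransform ψ R x) =
      neutral (courant S T x) (R x) + ψ.d x ![(S x).1, (T x).1, (R x).1] := by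
  have hswap : mvfderiv (𝓡 m) (fun y ↦ ψ.form y (T y).1 (S y).1) x =
      - mvfderiv (𝓡 m) (fun y ↦ ψ.form y (S y).1 (T y).1) x := by
    simp_rw [ψ.form_swap (T _).1]
    exact mvfderiv_neg (g := fun y ↦ ψ.form y (S y).1 (T y).1)
  rw [neutral_courant (R := bTransform ψ R) (hS.bTransform ψ) (hT.bTransform ψ) hR,
    neutral_courant hS hT hR,
    ψ.d_apply hS.1 hT.1 hR]
  have fst_bTransform (U : Π x : M, Big m x) (y : M) : (bTransform ψ U y).1 = (U y).1 := rfl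
  simp only [fst_bTransform, mvfderiv_bTransform ψ, hS, hT, hS.1, hT.1, hR, hswap]
  simp only [bTransform, add_apply, neg_apply, ψ.form_swap (mlieBracket _ _ _ x)]
  ring

theorem diffBig_flat (γ : RMetric m M) {X W : Π x : M, Tan m x} {x : M}
    (hX : DiffVF X x) (hW : DiffVF W x) : DiffBig (fun y ↦ (X y, γ.inner y (W y))) x :=
  ⟨hX, diffOneForm_clm_apply γ.contMDiff hW⟩

theorem neutral_courant_flat (γ : RMetric m M) {X₁ X₂ X₃ W₁ W₂ W₃ : Π x : M, Tan m x} {x : M}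
    (hX₁ : DiffVF X₁ x) (hX₂ : DiffVF X₂ x) (hX₃ : DiffVF X₃ x)
    (hW₁ : DiffVF W₁ x) (hW₂ : DiffVF W₂ x) (hW₃ : DiffVF W₃ x)
    (h₁₂ : pair γ W₂ X₁ = - pair γ W₁ X₂) (h₁₃ : pair γ W₃ X₁ = - pair γ W₁ X₃) :
    neutral (courant (fun y ↦ (X₁ y, γ.inner y (W₁ y))) (fun y ↦ (X₂ y, γ.inner y (W₂ y))) x)
        (X₃ x, γ.inner x (W₃ x)) =
      (γ.inner x (leviCivita γ W₂ x (X₁ x)) (X₃ x) + γ.inner x (W₃ x) (leviCivita γ X₂ x (X₁ x)))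
      + (γ.inner x (leviCivita γ W₃ x (X₂ x)) (X₁ x) + γ.inner x (W₁ x) (leviCivita γ X₃ x (X₂ x)))
      + (γ.inner x (leviCivita γ W₁ x (X₃ x)) (X₂ x)
        + γ.inner x (W₂ x) (leviCivita γ X₁ x (X₃ x))) := by
  have d₁₂ : mvfderiv (𝓡 m) (pair γ W₂ X₁) x (X₃ x) = - mvfderiv (𝓡 m) (pair γ W₁ X₂) x (X₃ x) := by
    rw [h₁₂, mvfderiv_neg, neg_apply]
  have d₁₃ : mvfderiv (𝓡 m) (pair γ W₃ X₁) x (X₂ x) = - mvfderiv (𝓡 m) (pair γ W₁ X₃) x (X₂ x) := by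
    rw [h₁₃, mvfderiv_neg, neg_apply]
  rw [neutral_courant (R := fun y ↦ (X₃ y, γ.inner y (W₃ y))) (diffBig_flat γ hX₁ hW₁)
    (diffBig_flat γ hX₂ hW₂) hX₃]
  change mvfderiv (𝓡 m) (pair γ W₂ X₃) x (X₁ x) - mvfderiv (𝓡 m) (pair γ W₁ X₃) x (X₂ x)
    + (1 / 2) * (mvfderiv (𝓡 m) (pair γ W₁ X₂) x (X₃ x) - mvfderiv (𝓡 m) (pair γ W₂ X₁) x (X₃ x))
    - γ.inner x (W₂ x) (mlieBracket (𝓡 m) X₁ X₃ x) + γ.inner x (W₁ x) (mlieBracket (𝓡 m) X₂ X₃ x)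
    + γ.inner x (W₃ x) (mlieBracket (𝓡 m) X₁ X₂ x) = _
  rw [d₁₂, γ.symm x (W₁ x) (mlieBracket _ _ _ x), γ.symm x (W₂ x) (mlieBracket _ _ _ x),
    γ.symm x (W₃ x) (mlieBracket _ _ _ x), inner_mlieBracket γ hX₁ hX₃, inner_mlieBracket γ hX₂ hX₃,
    inner_mlieBracket γ hX₁ hX₂]
  simp only [mvfderiv_pair γ, hX₁, hX₂, hX₃, hW₁, hW₂, hW₃] at d₁₃ ⊢
  simp only [γ.symm x (leviCivita γ X₁ x _), γ.symm x (leviCivita γ X₂ x _),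
    γ.symm x (leviCivita γ X₃ x _)]
  linear_combination -d₁₃

/-! ### Almost Dirac structures as graphs -/

/-- The vector `(a, ♭_{ψ+γ} a) + (b, ♭_{ψ-γ} b)` with components `a`, `b` in `V_+ ⊕ V_-`, both
bundles being identified with `TM`. -/
noncomputable def ofComponents (γ : RMetric m M) (ψ : TwoForm m M) (x : M) (a b : Tan m x) :
    Big m x :=
  (a, flatPM 1 γ ψ x a) + (b, flatPM (-1) γ ψ x b)

theorem ofComponents_eq (γ : RMetric m M) (ψ : TwoForm m M) (x : M) (a b : Tan m x) :
    ofComponents γ ψ x a b = (a + b, γ.inner x (a - b) + ψ.form x (a + b)) := by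
  refine Prod.ext rfl ?_
  simp only [ofComponents, flatPM, Prod.snd_add, add_apply, smul_apply, map_add, map_sub]
  module

theorem neutral_ofComponents (γ : RMetric m M) (ψ : TwoForm m M) (x : M) (a b c d : Tan m x) :
    neutral (ofComponents γ ψ x a b) (ofComponents γ ψ x c d) =
      2 * (γ.inner x a c - γ.inner x b d) := by
  simp only [ofComponents_eq, neutral, add_apply, map_add, map_sub, sub_apply]
  rw [γ.symm x c a, γ.symm x d a, γ.symm x c b, γ.symm x d b, ψ.form_swap c a, ψ.form_swap d a,
    ψ.form_swap c b, ψ.form_swap d b]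
  ring

/-- The component in `TM ≅ V_±` of a vector of `V_+ ⊕ V_-`, for `s = ±1`: the pointwise form of
`GenMetric.comp`. -/
noncomputable def GenMetric.compAt (G : GenMetric m M) (s : ℝ) (x : M) : Big m x →ₗ[ℝ] Tan m x :=
  LinearMap.fst ℝ _ _ ∘ₗ ((1 / 2 : ℝ) • (LinearMap.id + s • G.φ x))

theorem GenMetric.comp_apply (G : GenMetric m M) (s : ℝ) (S : Π x : M, Big m x) (x : M) :
    G.comp s S x = G.compAt s x (S x) := rfl

namespace GenMetric.Corresponds

variable {G : GenMetric m M} {γ : RMetric m M} {ψ : TwoForm m M}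

theorem half_add_φ (hG : G.Corresponds γ ψ) (x : M) (u : Big m x) :
    (1 / 2 : ℝ) • (u + G.φ x u) = (G.compAt 1 x u, flatPM 1 γ ψ x (G.compAt 1 x u)) := by
  have hV : (1 / 2 : ℝ) • (u + G.φ x u) ∈ (G.V 1 x : Set (Big m x)) := by
    rw [V, SetLike.mem_coe, End.mem_eigenspace_iff, map_smul, map_add, G.invol]
    module
  obtain ⟨a, ha⟩ := (hG x).1 ▸ hV
  have ha' : a = G.compAt 1 x u := by simpa [compAt] using congrArg Prod.fst ha
  rw [← ha, ← ha']

theorem half_sub_φ (hG : G.Corresponds γ ψ) (x : M) (u : Big m x) :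
    (1 / 2 : ℝ) • (u - G.φ x u) = (G.compAt (-1) x u, flatPM (-1) γ ψ x (G.compAt (-1) x u)) := by
  have hV : (1 / 2 : ℝ) • (u - G.φ x u) ∈ (G.V (-1) x : Set (Big m x)) := by
    rw [V, SetLike.mem_coe, End.mem_eigenspace_iff, map_smul, map_sub, G.invol]
    module
  obtain ⟨b, hb⟩ := (hG x).2 ▸ hV
  have hb' : b = G.compAt (-1) x u := by
    simpa [compAt, sub_eq_add_neg] using congrArg Prod.fst hb
  rw [← hb, ← hb']

theorem ofComponents_compAt (hG : G.Corresponds γ ψ) (x : M) (u : Big m x) :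
    ofComponents γ ψ x (G.compAt 1 x u) (G.compAt (-1) x u) = u := by
  rw [ofComponents, ← hG.half_add_φ, ← hG.half_sub_φ]
  module

theorem φ_ofComponents (hG : G.Corresponds γ ψ) (x : M) (a b : Tan m x) :
    G.φ x (ofComponents γ ψ x a b) = (a, flatPM 1 γ ψ x a) - (b, flatPM (-1) γ ψ x b) := by
  have ha : (a, flatPM 1 γ ψ x a) ∈ (G.V 1 x : Set (Big m x)) := (hG x).1 ▸ ⟨a, rfl⟩
  have hb : (b, flatPM (-1) γ ψ x b) ∈ (G.V (-1) x : Set (Big m x)) := (hG x).2 ▸ ⟨b, rfl⟩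
  rw [ofComponents, map_add, End.mem_eigenspace_iff.mp ha, End.mem_eigenspace_iff.mp hb]
  module

theorem compAt_one_ofComponents (hG : G.Corresponds γ ψ) (x : M) (a b : Tan m x) :
    G.compAt 1 x (ofComponents γ ψ x a b) = a := by
  have h := congrArg Prod.fst (hG.half_add_φ x (ofComponents γ ψ x a b))
  rw [hG.φ_ofComponents] at h
  refine h.symm.trans ?_
  change (1 / 2 : ℝ) • ((a + b) + (a - b)) = a
  module

theorem compAt_neg_one_ofComponents (hG : G.Corresponds γ ψ) (x : M) (a b : Tan m x) :
    G.compAt (-1) x (ofComponents γ ψ x a b) = b := by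
  have h := congrArg Prod.fst (hG.half_sub_φ x (ofComponents γ ψ x a b))
  rw [hG.φ_ofComponents] at h
  refine h.symm.trans ?_
  change (1 / 2 : ℝ) • ((a + b) - (a - b)) = b
  module

theorem neutral_eq (hG : G.Corresponds γ ψ) (x : M) (u v : Big m x) :
    neutral u v = 2 * (γ.inner x (G.compAt 1 x u) (G.compAt 1 x v) -
      γ.inner x (G.compAt (-1) x u) (G.compAt (-1) x v)) := by
  rw [← neutral_ofComponents γ ψ, hG.ofComponents_compAt, hG.ofComponents_compAt]

end GenMetric.Corresponds

theorem inner_self_eq_zero_iff (γ : RMetric m M) {x : M} {v : Tan m x} :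
    γ.inner x v v = 0 ↔ v = 0 := by
  refine ⟨fun h ↦ ?_, fun h ↦ by simp [h]⟩
  by_contra hv
  exact (γ.pos x v hv).ne' h

namespace AlmostDirac

variable {G : GenMetric m M} {γ : RMetric m M} {ψ : TwoForm m M} (E : AlmostDirac m M)

theorem para_of_mem (G : GenMetric m M) {x : M} {u : Big m x} (hu : u ∈ E.fib x) :
    E.para G x u = u := by
  rw [para, LinearMap.sub_apply, Submodule.projection_apply_of_mem_left _ hu,
    (Submodule.projection_apply_eq_zero_iff _).mpr hu, sub_zero]

theorem para_φ_of_mem (G : GenMetric m M) {x : M} {u : Big m x} (hu : u ∈ E.fib x) :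
    E.para G x (G.φ x u) = - G.φ x u := by
  have h : G.φ x u ∈ (E.fib x).map (G.φ x) := Submodule.mem_map_of_mem hu
  rw [para, LinearMap.sub_apply, Submodule.projection_apply_of_mem_left _ h,
    (Submodule.projection_apply_eq_zero_iff _).mpr h, zero_sub]

theorem F_compAt (hG : G.Corresponds γ ψ) {x : M} {u : Big m x} (hu : u ∈ E.fib x) :
    E.F G γ ψ x (G.compAt 1 x u) = G.compAt (-1) x u := by
  have h : E.para G x (G.compAt 1 x u, flatPM 1 γ ψ x (G.compAt 1 x u)) =
      (G.compAt (-1) x u, flatPM (-1) γ ψ x (G.compAt (-1) x u)) := by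
    rw [← hG.half_add_φ, ← hG.half_sub_φ, map_smul, map_add, E.para_of_mem G hu,
      E.para_φ_of_mem G hu, sub_eq_add_neg]
  exact congrArg Prod.fst h

theorem eq_zero_of_compAt_eq_zero (hG : G.Corresponds γ ψ) {x : M} {u : Big m x}
    (hu : u ∈ E.fib x) (h : G.compAt 1 x u = 0) : u = 0 := by
  have hb : G.compAt (-1) x u = 0 := by rw [← E.F_compAt hG hu, h, map_zero]
  rw [← hG.ofComponents_compAt x u, h, hb, ofComponents_eq]
  simp

theorem exists_mem_compAt_eq (hG : G.Corresponds γ ψ) (x : M) (v : Tan m x) :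
    ∃ u ∈ E.fib x, G.compAt 1 x u = v := by
  let L : E.fib x →ₗ[ℝ] Tan m x := G.compAt 1 x ∘ₗ (E.fib x).subtype
  have hL : Function.Injective L := by
    rw [injective_iff_map_eq_zero]
    exact fun u hu ↦ Subtype.ext (E.eq_zero_of_compAt_eq_zero hG u.2 hu)
  let _ : AddCommGroup (E.fib x) := Submodule.addCommGroup (E.fib x)
  obtain ⟨u, hu⟩ := (LinearEquiv.ofInjectiveOfFinrankEq L hL
    ((E.rank x).trans (finrank_tan x).symm)).surjective v
  exact ⟨u, u.2, hu⟩

theorem inner_F (hG : G.Corresponds γ ψ) (x : M) (v w : Tan m x) :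
    γ.inner x (E.F G γ ψ x v) (E.F G γ ψ x w) = γ.inner x v w := by
  obtain ⟨u, hu, rfl⟩ := E.exists_mem_compAt_eq hG x v
  obtain ⟨u', hu', rfl⟩ := E.exists_mem_compAt_eq hG x w
  have h := E.isotropic x u hu u' hu'
  rw [hG.neutral_eq] at h
  rw [E.F_compAt hG hu, E.F_compAt hG hu']
  linarith

theorem F_surjective (hG : G.Corresponds γ ψ) (x : M) : Function.Surjective (E.F G γ ψ x) := by
  rw [← LinearMap.injective_iff_surjective, injective_iff_map_eq_zero]
  intro v hv
  rw [← inner_self_eq_zero_iff γ, ← E.inner_F hG, hv, map_zero]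

theorem mem_fib_iff (hG : G.Corresponds γ ψ) {x : M} {u : Big m x} :
    u ∈ E.fib x ↔ G.compAt (-1) x u = E.F G γ ψ x (G.compAt 1 x u) := by
  refine ⟨fun hu ↦ (E.F_compAt hG hu).symm, fun h ↦ ?_⟩
  obtain ⟨w, hw, h₁⟩ := E.exists_mem_compAt_eq hG x (G.compAt 1 x u)
  have h₂ : G.compAt (-1) x w = G.compAt (-1) x u := by rw [h, ← h₁, E.F_compAt hG hw]
  rwa [← hG.ofComponents_compAt x u, ← h₁, ← h₂, hG.ofComponents_compAt]

/-- The section of `E` with `V_+`-component `Y`, namely `(Y, F_E Y)` in `V_+ ⊕ V_-`. -/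
noncomputable def lift (G : GenMetric m M) (γ : RMetric m M) (ψ : TwoForm m M)
    (Y : Π x : M, Tan m x) (x : M) : Big m x :=
  ofComponents γ ψ x (Y x) (E.F G γ ψ x (Y x))

theorem comp_one_lift (hG : G.Corresponds γ ψ) (Y : Π x : M, Tan m x) :
    G.comp 1 (E.lift G γ ψ Y) = Y :=
  funext fun x ↦ hG.compAt_one_ofComponents x _ _

theorem comp_neg_one_of_mem (hG : G.Corresponds γ ψ) {S : Π x : M, Big m x}
    (hS : ∀ x, S x ∈ E.fib x) : G.comp (-1) S = fun x ↦ E.F G γ ψ x (G.comp 1 S x) :=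
  funext fun x ↦ (E.F_compAt hG (hS x)).symm

theorem lift_comp_one (hG : G.Corresponds γ ψ) {S : Π x : M, Big m x}
    (hS : ∀ x, S x ∈ E.fib x) : E.lift G γ ψ (G.comp 1 S) = S := by
  ext1 x
  rw [lift, G.comp_apply, E.F_compAt hG (hS x), hG.ofComponents_compAt]

theorem lift_mem_fib (hG : G.Corresponds γ ψ) (Y : Π x : M, Tan m x) (x : M) :
    E.lift G γ ψ Y x ∈ E.fib x := by
  rw [E.mem_fib_iff hG, lift, hG.compAt_one_ofComponents, hG.compAt_neg_one_ofComponents]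

theorem mem_fib_of_neutral_eq_zero (hG : G.Corresponds γ ψ) {x : M} {u : Big m x}
    (h : ∀ w ∈ E.fib x, neutral u w = 0) : u ∈ E.fib x := by
  refine (E.mem_fib_iff hG).mpr (ext_inner γ fun v ↦ ?_)
  obtain ⟨a, rfl⟩ := E.F_surjective hG x v
  obtain ⟨w, hw, rfl⟩ := E.exists_mem_compAt_eq hG x a
  have hn := h w hw
  rw [hG.neutral_eq] at hn
  rw [E.inner_F hG, E.F_compAt hG hw]
  linarith

end AlmostDirac

theorem SmoothVF.diffVF {X : Π x : M, Tan m x} (hX : SmoothVF X) (x : M) : DiffVF X x :=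
  hX.contMDiffAt.mdifferentiableAt (by simp)

theorem exists_smoothVF [T2Space M] {x : M} (v : Tan m x) :
    ∃ X : Π y : M, Tan m y, SmoothVF X ∧ X x = v :=
  exists_contMDiff_section_eq (𝓡 m) (F := EuclideanSpace ℝ (Fin m)) (V := fun y : M ↦ Tan m y) v

theorem SmoothBigOn.smul_of_tsupport {U : Set M} (hU : IsOpen U) {f : M → ℝ}
    (hf : ContMDiff (𝓡 m) 𝓘(ℝ) ∞ f) (hfU : tsupport f ⊆ U) {S : Π x : M, Big m x}
    (hS : SmoothBigOn U S) : SmoothBig (fun y ↦ f y • S y) :=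
  ⟨(ContMDiffOn.smul_section_of_tsupport hf.contMDiffOn hU hfU hS.1).contMDiffOn,
    (ContMDiffOn.smul_section_of_tsupport (s := fun y ↦ (S y).2)
      hf.contMDiffOn hU hfU hS.2).contMDiffOn⟩

theorem GenMetric.smoothVF_comp (G : GenMetric m M) (s : ℝ) {S : Π x : M, Big m x}
    (hS : SmoothBig S) : SmoothVF (G.comp s S) :=
  ((contMDiffOn_univ.mp hS.1).add_section
    ((contMDiffOn_univ.mp (G.smooth S hS).1).const_smul_section (a := s))).const_smul_section

theorem contMDiff_clm_apply {A : Π x : M, Tan m x →L[ℝ] Tan m x →L[ℝ] ℝ}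
    (hA : ContMDiff (𝓡 m)
      ((𝓡 m).prod 𝓘(ℝ, EuclideanSpace ℝ (Fin m) →L[ℝ] EuclideanSpace ℝ (Fin m) →L[ℝ] ℝ)) ∞
      (fun x ↦ TotalSpace.mk' (EuclideanSpace ℝ (Fin m) →L[ℝ] EuclideanSpace ℝ (Fin m) →L[ℝ] ℝ)
        (E := fun x : M ↦ Tan m x →L[ℝ] Tan m x →L[ℝ] ℝ) x (A x)))
    {X : Π x : M, Tan m x} (hX : SmoothVF X) :
    ContMDiff (𝓡 m) ((𝓡 m).prod 𝓘(ℝ, EuclideanSpace ℝ (Fin m) →L[ℝ] ℝ)) ∞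
      (fun x ↦ TotalSpace.mk' (EuclideanSpace ℝ (Fin m) →L[ℝ] ℝ)
        (E := fun x : M ↦ Tan m x →L[ℝ] ℝ) x (A x (X x))) :=
  ContMDiff.clm_bundle_apply (F₁ := EuclideanSpace ℝ (Fin m))
    (E₁ := fun x : M ↦ Tan m x) (F₂ := EuclideanSpace ℝ (Fin m) →L[ℝ] ℝ)
    (E₂ := fun x : M ↦ Tan m x →L[ℝ] ℝ) (b := id) hA hX

theorem smoothBig_ofComponents (γ : RMetric m M) (ψ : TwoForm m M) {Y Z : Π x : M, Tan m x}
    (hY : SmoothVF Y) (hZ : SmoothVF Z) :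
    SmoothBig (fun x ↦ ofComponents γ ψ x (Y x) (Z x)) := by
  simp only [ofComponents_eq]
  have hadd : SmoothVF (fun x ↦ Y x + Z x) := ContMDiff.add_section hY hZ
  have hsub : SmoothVF (fun x ↦ Y x - Z x) := ContMDiff.sub_section hY hZ
  exact ⟨hadd.contMDiffOn, ((contMDiff_clm_apply γ.contMDiff hsub).add_section
    (contMDiff_clm_apply ψ.contMDiff hadd)).contMDiffOn⟩

namespace AlmostDirac

variable {G : GenMetric m M} {γ : RMetric m M} {ψ : TwoForm m M} (E : AlmostDirac m M)
  [T2Space M]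

theorem exists_sections (x₀ : M) : ∃ S : Fin m → Π x : M, Big m x,
    (∀ j, E.IsSection (S j)) ∧
      ∀ᶠ x in 𝓝 x₀, E.fib x = Submodule.span ℝ (Set.range fun j ↦ S j x) := by
  obtain ⟨U, hU, hx₀, e, he, hspan⟩ := E.smooth x₀
  obtain ⟨f, hf, hfx₀, hfU⟩ := exists_contMDiff_tsupport_subset (𝓡 m) (hU.mem_nhds hx₀)
  refine ⟨fun j y ↦ f y • e j y, fun j ↦ ⟨(he j).smul_of_tsupport hU hf hfU, fun y ↦ ?_⟩, ?_⟩
  · by_cases hy : y ∈ U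
    · rw [hspan y hy]
      exact Submodule.smul_mem _ _ (Submodule.subset_span ⟨j, rfl⟩)
    · change f y • e j y ∈ E.fib y
      rw [image_eq_zero_of_notMem_tsupport (mt (@hfU y) hy), zero_smul]
      exact zero_mem _
  · have hne : ∀ᶠ x in 𝓝 x₀, f x ≠ 0 :=
      hf.continuous.continuousAt.eventually_ne (by simp [hfx₀])
    filter_upwards [hU.mem_nhds hx₀, hne] with x hx hfx
    rw [hspan x hx, ← Submodule.span_smul_eq_of_isUnit _ (f x) hfx.isUnit, Set.smul_set_range]

theorem smoothVF_F (hG : G.Corresponds γ ψ) {Y : Π x : M, Tan m x} (hY : SmoothVF Y) :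
    SmoothVF (fun x ↦ E.F G γ ψ x (Y x)) := by
  -- For a local frame `S` of `E`, the coefficients of `Y` in the `V_+`-components of `S` are
  -- smooth, and `F_E Y` has the same coefficients in the `V_-`-components.
  intro x₀
  obtain ⟨S, hS, hspan⟩ := E.exists_sections x₀
  have hli : LinearIndependent ℝ fun j ↦ G.comp 1 (S j) x₀ := by
    refine linearIndependent_of_top_le_span_of_card_eq_finrank (fun v _ ↦ ?_)
      (by rw [Fintype.card_fin, finrank_tan])
    obtain ⟨u, hu, rfl⟩ := E.exists_mem_compAt_eq hG x₀ v
    rw [hspan.self_of_nhds] at hu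
    change _ ∈ Submodule.span ℝ (Set.range fun j ↦ G.compAt 1 x₀ (S j x₀))
    rw [Set.range_comp' (G.compAt 1 x₀), ← Submodule.map_span]
    exact Submodule.mem_map_of_mem hu
  have hexists : ∀ᶠ x in 𝓝 x₀, ∃ c : Fin m → ℝ, Y x = ∑ j, c j • G.comp 1 (S j) x := by
    filter_upwards [hspan] with x hx
    obtain ⟨u, hu, hY⟩ := E.exists_mem_compAt_eq hG x (Y x)
    rw [hx, Submodule.mem_span_range_iff_exists_fun] at hu
    obtain ⟨c, rfl⟩ := hu
    exact ⟨c, by simpa only [map_sum, map_smul, G.comp_apply] using hY.symm⟩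
  obtain ⟨c, hc⟩ := hexists.choice
  have hc_smooth : ContMDiffAt (𝓡 m) 𝓘(ℝ, Fin m → ℝ) ∞ c x₀ :=
    contMDiffAt_coeff_of_linearIndependent (fun j ↦ G.smoothVF_comp 1 (hS j).1 x₀) hli
      ((hY x₀).congr_of_eventuallyEq <| hc.mono fun x hx ↦ congrArg (TotalSpace.mk' _ x) hx.symm)
  have hF : ∀ᶠ x in 𝓝 x₀, E.F G γ ψ x (Y x) = ∑ j, c x j • G.comp (-1) (S j) x :=
    hc.mono fun x hx ↦ by
      simp only [hx, map_sum, map_smul, E.comp_neg_one_of_mem hG (hS _).2]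
  have hsum := ContMDiffAt.sum_section (s := Finset.univ) fun j _ ↦
    (contMDiffAt_pi_space.mp hc_smooth j).smul_section (G.smoothVF_comp (-1) (hS j).1 x₀)
  exact hsum.congr_of_eventuallyEq <| hF.mono fun x hx ↦ congrArg (TotalSpace.mk' _ x) hx

theorem isSection_lift (hG : G.Corresponds γ ψ) {Y : Π x : M, Tan m x} (hY : SmoothVF Y) :
    E.IsSection (E.lift G γ ψ Y) :=
  ⟨smoothBig_ofComponents γ ψ hY (E.smoothVF_F hG hY), E.lift_mem_fib hG Y⟩

end AlmostDirac

/-! ### Parallel Dirac structures -/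

theorem inner_connPM (s : ℝ) (γ : RMetric m M) (ψ : TwoForm m M) (Y : Π x : M, Tan m x) (x : M)
    (v w : Tan m x) :
    γ.inner x (connPM s γ ψ Y x v) w =
      γ.inner x (leviCivita γ Y x v) w + s / 2 * ψ.d x ![v, Y x, w] := by
  have hsharp : γ.inner x (sharp γ x (interior₃ v (Y x) (ψ.d x))) w = ψ.d x ![v, Y x, w] :=
    inner_sharp γ x _ w
  rw [connPM, map_add, map_smul, add_apply, smul_apply, smul_eq_mul, hsharp]

namespace AlmostDirac

variable {G : GenMetric m M} {γ : RMetric m M} {ψ : TwoForm m M} (E : AlmostDirac m M)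

theorem nabla_mem_fib_iff (hG : G.Corresponds γ ψ) {S : Π x : M, Big m x}
    (hS : ∀ x, S x ∈ E.fib x) (x : M) (v : Tan m x) :
    G.nabla γ ψ S x v ∈ E.fib x ↔
      connPM (-1) γ ψ (fun y ↦ E.F G γ ψ y (G.comp 1 S y)) x v =
        E.F G γ ψ x (connPM 1 γ ψ (G.comp 1 S) x v) := by
  have h : G.nabla γ ψ S x v = ofComponents γ ψ x (connPM 1 γ ψ (G.comp 1 S) x v)
    (connPM (-1) γ ψ (G.comp (-1) S) x v) := rfl
  rw [h, E.mem_fib_iff hG, hG.compAt_one_ofComponents, hG.compAt_neg_one_ofComponents,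
    E.comp_neg_one_of_mem hG hS]

theorem inner_connPM_F_sub (hG : G.Corresponds γ ψ) (X Y : Π x : M, Tan m x) (x : M)
    (z : Tan m x) :
    γ.inner x (connPM (-1) γ ψ (fun y ↦ E.F G γ ψ y (Y y)) x (X x)
        - E.F G γ ψ x (connPM 1 γ ψ Y x (X x))) (E.F G γ ψ x z) =
      γ.inner x (E.F G γ ψ x z) (covDerivEnd γ (E.F G γ ψ) X Y x) -
        (1 / 2 : ℝ) * (ψ.d x ![X x, Y x, z] +
          ψ.d x ![X x, E.F G γ ψ x (Y x), E.F G γ ψ x z]) := by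
  rw [covDerivEnd, map_sub, map_sub, sub_apply, γ.symm x (E.F G γ ψ x z),
    γ.symm x (E.F G γ ψ x z)]
  simp only [E.inner_F hG, inner_connPM]
  ring

theorem connPM_F_eq_iff (hG : G.Corresponds γ ψ) (X Y : Π x : M, Tan m x) (x : M) :
    connPM (-1) γ ψ (fun y ↦ E.F G γ ψ y (Y y)) x (X x) =
        E.F G γ ψ x (connPM 1 γ ψ Y x (X x)) ↔
      ∀ z : Tan m x, γ.inner x (E.F G γ ψ x z) (covDerivEnd γ (E.F G γ ψ) X Y x) =
        (1 / 2 : ℝ) * (ψ.d x ![X x, Y x, z] +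
          ψ.d x ![X x, E.F G γ ψ x (Y x), E.F G γ ψ x z]) := by
  refine ⟨fun h z ↦ ?_, fun h ↦ sub_eq_zero.mp (ext_inner γ fun w ↦ ?_)⟩
  · rw [← sub_eq_zero, ← E.inner_connPM_F_sub hG, h, sub_self, map_zero, zero_apply]
  · obtain ⟨z, rfl⟩ := E.F_surjective hG x w
    rw [E.inner_connPM_F_sub hG, h z, sub_self, map_zero, zero_apply]

theorem isPreserved_iff [T2Space M] (hG : G.Corresponds γ ψ) : E.IsPreserved G γ ψ ↔
    ∀ X Y Z : Π x : M, Tan m x, SmoothVF X → SmoothVF Y → SmoothVF Z → ∀ x : M,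
      γ.inner x (E.F G γ ψ x (Z x)) (covDerivEnd γ (E.F G γ ψ) X Y x) =
        (1 / 2 : ℝ) * (ψ.d x ![X x, Y x, Z x] +
          ψ.d x ![X x, E.F G γ ψ x (Y x), E.F G γ ψ x (Z x)]) := by
  constructor
  · intro h X Y Z _ hY _ x
    have hS := E.isSection_lift hG hY
    have hcomm := (E.nabla_mem_fib_iff hG hS.2 x (X x)).mp (h _ hS x (X x))
    rw [E.comp_one_lift hG] at hcomm
    exact (E.connPM_F_eq_iff hG X Y x).mp hcomm (Z x)
  · intro h S hS x v
    obtain ⟨X, hX, rfl⟩ := exists_smoothVF v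
    rw [E.nabla_mem_fib_iff hG hS.2, E.connPM_F_eq_iff hG]
    intro z
    obtain ⟨Z, hZ, rfl⟩ := exists_smoothVF z
    exact h X _ Z hX (G.smoothVF_comp 1 hS.1) hZ x

theorem lift_eq_bTransform (G : GenMetric m M) (γ : RMetric m M) (ψ : TwoForm m M)
    (Y : Π x : M, Tan m x) :
    E.lift G γ ψ Y = bTransform ψ fun y ↦
      (Y y + E.F G γ ψ y (Y y), γ.inner y (Y y - E.F G γ ψ y (Y y))) :=
  funext fun y ↦ ofComponents_eq γ ψ y _ _

theorem pair_sub_F_add_F (hG : G.Corresponds γ ψ) (Y Z : Π x : M, Tan m x) :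
    pair γ (fun y ↦ Z y - E.F G γ ψ y (Z y)) (fun y ↦ Y y + E.F G γ ψ y (Y y)) =
      - pair γ (fun y ↦ Y y - E.F G γ ψ y (Y y)) (fun y ↦ Z y + E.F G γ ψ y (Z y)) := by
  ext y
  simp only [pair, Pi.neg_apply, map_add, map_sub, sub_apply, E.inner_F hG]
  rw [γ.symm y (Z y) (Y y), γ.symm y (Z y), γ.symm y (E.F G γ ψ y (Z y)) (Y y)]
  ring

theorem inner_leviCivita_sub_F_add_F (hG : G.Corresponds γ ψ) {Y : Π x : M, Tan m x} {x : M}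
    (hY : DiffVF Y x) (hFY : DiffVF (fun y ↦ E.F G γ ψ y (Y y)) x) (X : Π x : M, Tan m x)
    (z : Tan m x) :
    γ.inner x (leviCivita γ (fun y ↦ Y y - E.F G γ ψ y (Y y)) x (X x)) (z + E.F G γ ψ x z) +
      γ.inner x (z - E.F G γ ψ x z) (leviCivita γ (fun y ↦ Y y + E.F G γ ψ y (Y y)) x (X x)) =
    -2 * γ.inner x (E.F G γ ψ x z) (covDerivEnd γ (E.F G γ ψ) X Y x) := by
  rw [covDerivEnd, leviCivita_sub γ hY hFY, leviCivita_add γ hY hFY,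
    γ.symm x (z - _) (_ + _)]
  simp only [map_add, map_sub, add_apply, sub_apply, E.inner_F hG,
    γ.symm x (E.F G γ ψ x z) (leviCivita _ _ _ _), γ.symm x z]
  ring

theorem neutral_courant_lift (hG : G.Corresponds γ ψ) {Y₁ Y₂ Y₃ : Π x : M, Tan m x} {x : M}
    (h₁ : DiffVF Y₁ x) (h₂ : DiffVF Y₂ x) (h₃ : DiffVF Y₃ x)
    (hF₁ : DiffVF (fun y ↦ E.F G γ ψ y (Y₁ y)) x) (hF₂ : DiffVF (fun y ↦ E.F G γ ψ y (Y₂ y)) x)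
    (hF₃ : DiffVF (fun y ↦ E.F G γ ψ y (Y₃ y)) x) :
    neutral (courant (E.lift G γ ψ Y₁) (E.lift G γ ψ Y₂) x) (E.lift G γ ψ Y₃ x) =
      ψ.d x ![Y₁ x + E.F G γ ψ x (Y₁ x), Y₂ x + E.F G γ ψ x (Y₂ x), Y₃ x + E.F G γ ψ x (Y₃ x)]
      - 2 * (γ.inner x (E.F G γ ψ x (Y₃ x))
          (covDerivEnd γ (E.F G γ ψ) (fun y ↦ Y₁ y + E.F G γ ψ y (Y₁ y)) Y₂ x)
        + γ.inner x (E.F G γ ψ x (Y₁ x))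
          (covDerivEnd γ (E.F G γ ψ) (fun y ↦ Y₂ y + E.F G γ ψ y (Y₂ y)) Y₃ x)
        + γ.inner x (E.F G γ ψ x (Y₂ x))
          (covDerivEnd γ (E.F G γ ψ) (fun y ↦ Y₃ y + E.F G γ ψ y (Y₃ y)) Y₁ x)) := by
  have hadd {Y : Π x : M, Tan m x} (hY : DiffVF Y x) (hFY : DiffVF (fun y ↦ E.F G γ ψ y (Y y)) x) :
      DiffVF (fun y ↦ Y y + E.F G γ ψ y (Y y)) x := mdifferentiableAt_add_section hY hFY
  have hsub {Y : Π x : M, Tan m x} (hY : DiffVF Y x) (hFY : DiffVF (fun y ↦ E.F G γ ψ y (Y y)) x) :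
      DiffVF (fun y ↦ Y y - E.F G γ ψ y (Y y)) x := mdifferentiableAt_sub_section hY hFY
  rw [E.lift_eq_bTransform, E.lift_eq_bTransform, E.lift_eq_bTransform,
    neutral_courant_bTransform ψ (diffBig_flat γ (hadd h₁ hF₁) (hsub h₁ hF₁))
      (diffBig_flat γ (hadd h₂ hF₂) (hsub h₂ hF₂)) (hadd h₃ hF₃),
    neutral_courant_flat γ (hadd h₁ hF₁) (hadd h₂ hF₂) (hadd h₃ hF₃) (hsub h₁ hF₁) (hsub h₂ hF₂)
      (hsub h₃ hF₃) (E.pair_sub_F_add_F hG Y₁ Y₂) (E.pair_sub_F_add_F hG Y₁ Y₃),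
    E.inner_leviCivita_sub_F_add_F hG h₂ hF₂ (fun y ↦ Y₁ y + E.F G γ ψ y (Y₁ y)),
    E.inner_leviCivita_sub_F_add_F hG h₃ hF₃ (fun y ↦ Y₂ y + E.F G γ ψ y (Y₂ y)),
    E.inner_leviCivita_sub_F_add_F hG h₁ hF₁ (fun y ↦ Y₃ y + E.F G γ ψ y (Y₃ y))]
  ring

variable [T2Space M]

theorem neutral_courant_lift_of_isPreserved (hG : G.Corresponds γ ψ) (h : E.IsPreserved G γ ψ)
    {Y₁ Y₂ Y₃ : Π x : M, Tan m x} (h₁ : SmoothVF Y₁) (h₂ : SmoothVF Y₂) (h₃ : SmoothVF Y₃)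
    (x : M) :
    neutral (courant (E.lift G γ ψ Y₁) (E.lift G γ ψ Y₂) x) (E.lift G γ ψ Y₃ x) =
      -2 * (ψ.d x ![Y₁ x, Y₂ x, Y₃ x] +
        ψ.d x ![E.F G γ ψ x (Y₁ x), E.F G γ ψ x (Y₂ x), E.F G γ ψ x (Y₃ x)]) := by
  have hF {Y : Π x : M, Tan m x} (hY : SmoothVF Y) : SmoothVF (fun y ↦ E.F G γ ψ y (Y y)) :=
    E.smoothVF_F hG hY
  have hadd {Y : Π x : M, Tan m x} (hY : SmoothVF Y) :
      SmoothVF (fun y ↦ Y y + E.F G γ ψ y (Y y)) := ContMDiff.add_section hY (hF hY)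
  have hcov := (E.isPreserved_iff hG).mp h
  have hcyc := alternatingMap_add_sub_cyclic (ψ.d x).toAlternatingMap (Y₁ x) (Y₂ x) (Y₃ x)
    (E.F G γ ψ x (Y₁ x)) (E.F G γ ψ x (Y₂ x)) (E.F G γ ψ x (Y₃ x))
  simp only [ContinuousAlternatingMap.coe_toAlternatingMap, zsmul_eq_mul] at hcyc
  rw [E.neutral_courant_lift hG (h₁.diffVF x) (h₂.diffVF x) (h₃.diffVF x) ((hF h₁).diffVF x)
    ((hF h₂).diffVF x) ((hF h₃).diffVF x), hcov _ _ _ (hadd h₁) h₂ h₃ x,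
    hcov _ _ _ (hadd h₂) h₃ h₁ x, hcov _ _ _ (hadd h₃) h₁ h₂ x]
  push_cast at hcyc
  linear_combination hcyc

theorem isDirac_iff_of_isPreserved (hG : G.Corresponds γ ψ) (h : E.IsPreserved G γ ψ) :
    E.IsDirac ↔
      ∀ X Y Z : Π x : M, Tan m x, SmoothVF X → SmoothVF Y → SmoothVF Z → ∀ x : M,
        ψ.d x ![X x, Y x, Z x] +
          ψ.d x ![E.F G γ ψ x (X x), E.F G γ ψ x (Y x), E.F G γ ψ x (Z x)] = 0 := by
  constructor
  · intro hD X Y Z hX hY hZ x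
    have hC := E.neutral_courant_lift_of_isPreserved hG h hX hY hZ x
    rw [E.isotropic x _ (hD _ _ (E.isSection_lift hG hX) (E.isSection_lift hG hY) x) _
      (E.lift_mem_fib hG Z x)] at hC
    linarith
  · intro hd S T hS hT x
    refine E.mem_fib_of_neutral_eq_zero hG fun w hw ↦ ?_
    obtain ⟨Z, hZ, hZx⟩ := exists_smoothVF (G.compAt 1 x w)
    have hw_lift : w = E.lift G γ ψ Z x := by
      rw [lift, hZx, E.F_compAt hG hw, hG.ofComponents_compAt]
    have hX := G.smoothVF_comp 1 hS.1
    have hY := G.smoothVF_comp 1 hT.1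
    rw [hw_lift, ← E.lift_comp_one hG hS.2, ← E.lift_comp_one hG hT.2,
      E.neutral_courant_lift_of_isPreserved hG h hX hY hZ, hd _ _ _ hX hY hZ, mul_zero]

end AlmostDirac

end GenRiem

theorem proposition3p5 {m : ℕ} {M : Type*} [TopologicalSpace M] [T2Space M]
    [ChartedSpace (EuclideanSpace ℝ (Fin m)) M] [IsManifold (𝓡 m) ∞ M]
    (G : GenRiem.GenMetric m M) (γ : GenRiem.RMetric m M) (ψ : GenRiem.TwoForm m M)
    (hG : G.Corresponds γ ψ) (E : GenRiem.AlmostDirac m M) :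
    E.IsParallelDirac G γ ψ ↔
      (∀ X Y Z : Π x : M, GenRiem.Tan m x,
        GenRiem.SmoothVF X → GenRiem.SmoothVF Y → GenRiem.SmoothVF Z → ∀ x : M,
          γ.inner x (E.F G γ ψ x (Z x)) (GenRiem.covDerivEnd γ (E.F G γ ψ) X Y x) =
            (1 / 2 : ℝ) * (ψ.d x ![X x, Y x, Z x] +
              ψ.d x ![X x, E.F G γ ψ x (Y x), E.F G γ ψ x (Z x)])) ∧
      (∀ X Y Z : Π x : M, GenRiem.Tan m x,
        GenRiem.SmoothVF X → GenRiem.SmoothVF Y → GenRiem.SmoothVF Z → ∀ x : M,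
          ψ.d x ![X x, Y x, Z x] +
            ψ.d x ![E.F G γ ψ x (X x), E.F G γ ψ x (Y x), E.F G γ ψ x (Z x)] = 0) := by
  unfold GenRiem.AlmostDirac.IsParallelDirac
  rw [and_comm, ← E.isPreserved_iff hG]
  exact and_congr_right fun h ↦ E.isDirac_iff_of_isPreserved hG h
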